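/- All monoids are commutative. A pointed monoid is a monoid $A$ with an absorbing element $0$; it is a pointed group if its units are exactly its nonzero elements. A congruence on $A$ is an equivalence relation compatible with multiplication; its null ideal is $\{a\in A \mid a\sim 0\}$. It is prime if $A/\mathfrak c$ is integral (i.e. $0\neq 1$, and $ab=ac$ implies $a=0$ or $b=c$), and strong prime if $A/\mathfrak c$ is isomorphic to a pointed submonoid of $K^\bullet$ for some field $K$, where $(-)^\bullet$ denotes the underlying multiplicative pointed monoid of a ring. Let $\mathrm{Cong}\,A$ be the set of prime congruences, with the topology generated by the sets $\{\mathfrak c\mid (a,b)\notin\mathfrak c\}$, and $\mathrm{SCong}\,A\subseteq \mathrm{Cong}\,A$ the subspace of strong prime congruences. Let $X$ be a monoid scheme and $R$ a commutative ring with unit. With $U$ running over the affine open subsets of $X$ and $\Gamma U$ denoting sections over $U$, put $X^{\mathrm{cong}}=\mathrm{colim}_U\,\mathrm{Cong}\,\Gamma U$, $\mathrm{SCong}\,X=\mathrm{colim}_U\,\mathrm{SCong}\,\Gamma U$ and $X_R=\mathrm{colim}_U\,U_R$, where $U_R=\mathrm{Spec}\big((\Gamma U)_R\big)$ and $A_R=R[A]/\langle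 1_R0_A\rangle$. Let $\pi_X\colon X^{\mathrm{cong}}\to X$ send a prime congruence on $\Gamma U$ to the point of $U\cong\mathrm{MSpec}\,\Gamma U$ given by its null ideal. Let $p_R\colon X_R^\bullet\to X$ be the morphism which, over each affine open $U$, is given by $\mathfrak p\mapsto \mathfrak p\cap\Gamma U$ on points of $U_R=p_R^{-1}(U)$ and by $a\mapsto 1_Ra$, $\Gamma U\to (\Gamma U)_R^\bullet=\Gamma(U_R,\mathcal O_{X_R})^\bullet$, on sections. Its underlying map factorizes as $p_R=\pi_X\circ\gamma$, where $\gamma\colon X_R\to\mathrm{SCong}\,X\subseteq X^{\mathrm{cong}}$ is the continuous map sending $\mathfrak p\in U_R$ to the strong prime congruence $\{(a,b)\mid \overline{1_Ra}=\overline{1_Rb}\in(\Gamma U)_R/\mathfrak p\}$ on $\Gamma U$, for every affine open $U$. For $\tilde x\in X^{\mathrm{cong}}$ let $\kappa(\tilde x)=\mathcal O_{X,\pi_X(\tilde x)}/\mathfrak c_{\tilde x}$, where $\mathfrak c_{\tilde x}$ is the congruence generated by the push-forwards, along $\Gamma U\to\mathcal O_{X,\pi_X(\tilde x)}$, of the prime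 congruences on $\Gamma U$ corresponding to $\tilde x$, for all affine open neighbourhoods $U$ of $\pi_X(\tilde x)$. Then for every $x\in X_R$, with residue field $\kappa(x)$ of the scheme $X_R$ at $x$, the pointed monoid $\kappa(\gamma(x))$ is a pointed group, and the factorization of $p_R$ through $\gamma$ induces an injective morphism of pointed groups $\gamma_x\colon\kappa(\gamma(x))\to\kappa(x)^\bullet$: there is a unique morphism $\gamma_x$ such that, for every affine open $U\subseteq X$ with $x\in U_R$, the composition $\Gamma U\to\mathcal O_{X,p_R(x)}\to\kappa(\gamma(x))\xrightarrow{\gamma_x}\kappa(x)^\bullet$ equals the composition $\Gamma U\to\Gamma(U_R,\mathcal O_{X_R})^\bullet\to\kappa(x)^\bullet$ of $p_R^\#(U)$ with evaluation at $x$; and this $\gamma_x$ is injective. -/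

import Mathlib

universe u

noncomputable section

open CategoryTheory CategoryTheory.Limits AlgebraicGeometry TopologicalSpace

namespace F1

/-- `A` is a pointed group: its units are exactly its nonzero elements. -/
def IsPointedGroup (A : Type u) [CommMonoidWithZero A] : Prop :=
  ∀ a : A, IsUnit a ↔ a ≠ 0

/-- `A` is a domain: it embeds as a pointed submonoid into the multiplicative monoid of a field. -/
def IsDomainMonoid (A : Type u) [CommMonoidWithZero A] : Prop :=
  ∃ (K : Type u) (_ : Field K) (f : A →*₀ K), Function.Injective f

/-- `A` is integral (cancellative), and `0 ≠ 1`. -/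
def IsIntegralMonoid (A : Type u) [CommMonoidWithZero A] : Prop :=
  (0 : A) ≠ 1 ∧ ∀ a b c : A, a * b = a * c → a = 0 ∨ b = c

theorem IsDomainMonoid.isIntegralMonoid {A : Type u} [CommMonoidWithZero A]
    (h : IsDomainMonoid A) : IsIntegralMonoid A := by
  obtain ⟨K, _, f, hf⟩ := h
  refine ⟨fun h => zero_ne_one (α := K) (by rw [← map_zero f, h, map_one]), fun a b c h => ?_⟩
  have h' := congrArg f h
  rw [map_mul, map_mul] at h'
  rcases mul_eq_mul_left_iff.1 h' with h' | h'
  · exact .inr (hf h')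
  · exact .inl (hf (h'.trans (map_zero f).symm))

/-- The quotient `A / c` of a pointed monoid by a congruence is a pointed monoid. -/
instance conQuotientCommMonoidWithZero {A : Type u} [CommMonoidWithZero A] (c : Con A) :
    CommMonoidWithZero c.Quotient where
  zero := ((0 : A) : c.Quotient)
  zero_mul a := by
    induction a using Con.induction_on with
    | H a => exact congrArg (fun x : A => (x : c.Quotient)) (zero_mul a)
  mul_zero a := by
    induction a using Con.induction_on with
    | H a => exact congrArg (fun x : A => (x : c.Quotient)) (mul_zero a)

/-- The quotient projection `A → A / c`. -/
def conMk {A : Type u} [CommMonoidWithZero A] (c : Con A) : A →*₀ c.Quotient where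
  toFun a := a
  map_zero' := rfl
  map_one' := rfl
  map_mul' _ _ := rfl

theorem conMk_eq {A : Type u} [CommMonoidWithZero A] {c : Con A} {a b : A} :
    conMk c a = conMk c b ↔ c a b := c.eq

/-- The pullback of a congruence along a morphism. -/
def conComap {A B : Type u} [CommMonoidWithZero A] [CommMonoidWithZero B] (f : A →*₀ B)
    (c : Con B) : Con A :=
  Con.comap f (map_mul f) c

theorem conComap_iff {A B : Type u} [CommMonoidWithZero A] [CommMonoidWithZero B] {f : A →*₀ B}
    {c : Con B} {a b : A} : conComap f c a b ↔ c (f a) (f b) := Iff.rfl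

/-- The injection `A / f^*(c) → B / c`. -/
def conComapMap {A B : Type u} [CommMonoidWithZero A] [CommMonoidWithZero B] (f : A →*₀ B)
    (c : Con B) : (conComap f c).Quotient →*₀ c.Quotient where
  toFun := Quotient.map' f (fun _ _ h => h)
  map_zero' := congrArg (conMk c) (map_zero f)
  map_one' := congrArg (conMk c) (map_one f)
  map_mul' x y := by
    induction x, y using Con.induction_on₂ with
    | H x y => exact congrArg (conMk c) (map_mul f x y)

theorem conComapMap_injective {A B : Type u} [CommMonoidWithZero A] [CommMonoidWithZero B]
    (f : A →*₀ B) (c : Con B) : Function.Injective (conComapMap f c) := by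
  intro x y h
  induction x, y using Con.induction_on₂ with
  | H x y => exact (Con.eq _).2 ((Con.eq c).1 h)

/-- The set of prime congruences of `A`. -/
def Cong (A : Type u) [CommMonoidWithZero A] : Type u :=
  {c : Con A // IsIntegralMonoid c.Quotient}

/-- The topology on `Cong A` generated by the sets `U_{a,b} = {c | (a, b) ∉ c}`. -/
instance Cong.topology (A : Type u) [CommMonoidWithZero A] : TopologicalSpace (Cong A) :=
  TopologicalSpace.generateFrom {W | ∃ a b : A, W = {c | ¬ c.1 a b}}

/-- The set of strong prime congruences of `A`. -/
def SCong (A : Type u) [CommMonoidWithZero A] : Type u :=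
  {c : Con A // IsDomainMonoid c.Quotient}

/-- The inclusion of the strong prime congruences into the prime congruences. -/
def SCong.toCong {A : Type u} [CommMonoidWithZero A] (c : SCong A) : Cong A :=
  ⟨c.1, c.2.isIntegralMonoid⟩

/-- The subspace topology on `SCong A`. -/
instance SCong.topology (A : Type u) [CommMonoidWithZero A] : TopologicalSpace (SCong A) :=
  TopologicalSpace.induced SCong.toCong (Cong.topology A)

section functoriality

variable {A B : Type u} [CommMonoidWithZero A] [CommMonoidWithZero B]

/-- The continuous map `f^* : Cong B → Cong A`. -/
def Cong.comap (f : A →*₀ B) : C(Cong B, Cong A) where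
  toFun c := ⟨conComap f c.1, by
    refine ⟨fun h => c.2.1 ?_, fun x y z h => ?_⟩
    · simpa using congrArg (conComapMap f c.1) h
    · have h' := congrArg (conComapMap f c.1) h
      rw [map_mul, map_mul] at h'
      refine (c.2.2 _ _ _ h').imp (fun h => ?_) (fun h => conComapMap_injective f c.1 h)
      exact conComapMap_injective f c.1 (h.trans (map_zero _).symm)⟩
  continuous_toFun := by
    refine continuous_generateFrom_iff.2 ?_
    rintro _ ⟨a, b, rfl⟩
    exact TopologicalSpace.isOpen_generateFrom_of_mem ⟨f a, f b, rfl⟩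

/-- The continuous map `f^* : SCong B → SCong A`. -/
def SCong.comap (f : A →*₀ B) : C(SCong B, SCong A) where
  toFun c := ⟨conComap f c.1, by
    obtain ⟨K, hK, g, hg⟩ := c.2
    exact ⟨K, hK, g.comp (conComapMap f c.1), hg.comp (conComapMap_injective f c.1)⟩⟩
  continuous_toFun :=
    continuous_induced_rng.2
      (((Cong.comap f).continuous.comp (continuous_induced_dom (f := SCong.toCong))))

end functoriality

/-- A (proper) prime ideal of a pointed monoid; these are the points of `MSpec A`. -/
@[ext]
structure MSpec (A : Type u) [CommMonoidWithZero A] where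
  carrier : Set A
  zero_mem : (0 : A) ∈ carrier
  mul_mem : ∀ a x : A, x ∈ carrier → a * x ∈ carrier
  one_notMem : (1 : A) ∉ carrier
  mem_or_mem : ∀ a b : A, a * b ∈ carrier → a ∈ carrier ∨ b ∈ carrier

/-- The topology on `MSpec A` generated by the principal opens `U_h = {I | h ∉ I}`. -/
instance MSpec.topology (A : Type u) [CommMonoidWithZero A] : TopologicalSpace (MSpec A) :=
  TopologicalSpace.generateFrom {W | ∃ h : A, W = {p | h ∉ p.carrier}}

/-- The null ideal `{a | (a, 0) ∈ c}` of a prime congruence, as a continuous map. -/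
def Cong.nullIdeal (A : Type u) [CommMonoidWithZero A] : C(Cong A, MSpec A) where
  toFun c :=
    { carrier := {a | c.1 a 0}
      zero_mem := c.1.refl 0
      mul_mem := fun a x hx => by simpa using c.1.mul (c.1.refl a) hx
      one_notMem := fun h => c.2.1 (conMk_eq.2 (c.1.symm h))
      mem_or_mem := fun a b h => by
        have h' : conMk c.1 a * conMk c.1 b = conMk c.1 a * conMk c.1 0 := by
          rw [← map_mul, ← map_mul, conMk_eq, mul_zero]; exact h
        refine (c.2.2 _ _ _ h').imp (fun h => ?_) (fun h => conMk_eq.1 h)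
        exact conMk_eq.1 (h.trans (map_zero _).symm) }
  continuous_toFun := by
    refine continuous_generateFrom_iff.2 ?_
    rintro _ ⟨a, rfl⟩
    exact TopologicalSpace.isOpen_generateFrom_of_mem ⟨a, 0, rfl⟩

/-- A monoidal space: a topological space with a sheaf of pointed monoids on it. -/
structure MonoidalSpace where
  carrier : Type u
  [top : TopologicalSpace carrier]
  /-- sections over an open set -/
  sec : Opens carrier → Type u
  [mon : ∀ U, CommMonoidWithZero (sec U)]
  /-- restriction of sections -/
  res : ∀ {U V : Opens carrier}, U ≤ V → sec V →*₀ sec U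
  res_refl : ∀ {U : Opens carrier} (s : sec U), res le_rfl s = s
  res_res : ∀ {U V W : Opens carrier} (h : U ≤ V) (h' : V ≤ W) (s : sec W),
    res h (res h' s) = res (h.trans h') s
  /-- the sheaf axiom -/
  glue : ∀ {ι : Type u} {W : Opens carrier} (U : ι → Opens carrier) (hU : ∀ i, U i ≤ W),
    W ≤ ⨆ i, U i → ∀ s : ∀ i, sec (U i),
    (∀ i j, res (inf_le_left : U i ⊓ U j ≤ U i) (s i) =
      res (inf_le_right : U i ⊓ U j ≤ U j) (s j)) →
    ∃! t : sec W, ∀ i, res (hU i) t = s i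

attribute [instance] MonoidalSpace.top MonoidalSpace.mon

namespace MonoidalSpace

variable (X : MonoidalSpace.{u})

instance : CoeSort MonoidalSpace.{u} (Type u) := ⟨carrier⟩

/-- Open neighbourhoods of a point, ordered by reverse inclusion. -/
abbrev Nhd (x : X) : Type u := {U : Opens X // x ∈ U}ᵒᵈ

instance (x : X) : Nonempty (X.Nhd x) := ⟨OrderDual.toDual ⟨⊤, trivial⟩⟩

instance (x : X) : IsDirectedOrder (X.Nhd x) :=
  ⟨fun U V => ⟨OrderDual.toDual ⟨(OrderDual.ofDual U).1 ⊓ (OrderDual.ofDual V).1,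
    (OrderDual.ofDual U).2, (OrderDual.ofDual V).2⟩,
    show (OrderDual.ofDual U).1 ⊓ (OrderDual.ofDual V).1 ≤ (OrderDual.ofDual U).1 from inf_le_left,
    show (OrderDual.ofDual U).1 ⊓ (OrderDual.ofDual V).1 ≤ (OrderDual.ofDual V).1 from
      inf_le_right⟩⟩

/-- The system of sections over the open neighbourhoods of a point. -/
abbrev nhdSec (x : X) (U : X.Nhd x) : Type u := X.sec (OrderDual.ofDual U).1

/-- Restriction maps of the system of sections over open neighbourhoods. -/
abbrev nhdRes (x : X) (U V : X.Nhd x) (h : U ≤ V) : X.nhdSec x U →*₀ X.nhdSec x V :=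
  X.res (show (OrderDual.ofDual V).1 ≤ (OrderDual.ofDual U).1 from h)

instance (x : X) : DirectedSystem (X.nhdSec x) (fun U V h => X.nhdRes x U V h) where
  map_self _ _ := X.res_refl _
  map_map _ _ _ _ _ _ := X.res_res _ _ _

/-- The stalk of the structure sheaf at a point: the direct limit of the sections over the
open neighbourhoods of the point. -/
def Stalk (x : X) : Type u := DirectLimit (X.nhdSec x) (X.nhdRes x)

instance (x : X) : CommMonoidWithZero (X.Stalk x) :=
  inferInstanceAs (CommMonoidWithZero (DirectLimit (X.nhdSec x) (X.nhdRes x)))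

/-- The germ of a section at a point. -/
def germ (U : Opens X) (x : X) (hx : x ∈ U) : X.sec U →*₀ X.Stalk x where
  toFun s := Quotient.mk (DirectLimit.setoid (X.nhdRes x)) ⟨OrderDual.toDual ⟨U, hx⟩, s⟩
  map_zero' := (DirectLimit.zero_def (f := X.nhdRes x) _).symm
  map_one' := (DirectLimit.one_def (f := X.nhdRes x) _).symm
  map_mul' a b := (DirectLimit.mul_def (G := X.nhdSec x) (f := X.nhdRes x)
    (OrderDual.toDual ⟨U, hx⟩) a b).symm

variable {X}

theorem germ_res {U V : Opens X} (h : U ≤ V) (x : X) (hx : x ∈ U) (s : X.sec V) :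
    X.germ U x hx (X.res h s) = X.germ V x (h hx) s :=
  Quotient.sound (s := DirectLimit.setoid (X.nhdRes x))
    ⟨OrderDual.toDual ⟨U, hx⟩, le_rfl, h, X.res_res _ _ _⟩

theorem exists_germ (x : X) (s : X.Stalk x) : ∃ U, ∃ hx : x ∈ U, ∃ t, X.germ U x hx t = s := by
  obtain ⟨⟨U, t⟩⟩ := s
  exact ⟨(OrderDual.ofDual U).1, (OrderDual.ofDual U).2, t, rfl⟩

theorem exists_res_eq_of_germ_eq {U V : Opens X} {x : X} {hU : x ∈ U} {hV : x ∈ V} {s : X.sec U}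
    {t : X.sec V} (h : X.germ U x hU s = X.germ V x hV t) :
    ∃ (W : Opens X) (hWU : W ≤ U) (hWV : W ≤ V), x ∈ W ∧ X.res hWU s = X.res hWV t := by
  obtain ⟨W, h1, h2, h3⟩ := Quotient.exact (s := DirectLimit.setoid (X.nhdRes x)) h
  exact ⟨(OrderDual.ofDual W).1, h1, h2, (OrderDual.ofDual W).2, h3⟩

theorem isUnit_germ_iff {U : Opens X} {x : X} {hx : x ∈ U} {s : X.sec U} :
    IsUnit (X.germ U x hx s) ↔ ∃ (W : Opens X) (hW : W ≤ U), x ∈ W ∧ IsUnit (X.res hW s) := by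
  refine ⟨fun h => ?_, fun ⟨W, hW, hxW, h⟩ => ?_⟩
  · obtain ⟨t, ht⟩ := h.exists_right_inv
    obtain ⟨V, hV, t, rfl⟩ := exists_germ x t
    rw [← germ_res (inf_le_left : U ⊓ V ≤ U) x ⟨hx, hV⟩,
      ← germ_res (inf_le_right : U ⊓ V ≤ V) x ⟨hx, hV⟩, ← map_mul,
      ← map_one (X.germ (U ⊓ V) x ⟨hx, hV⟩)] at ht
    obtain ⟨W, h1, _, hxW, h3⟩ := exists_res_eq_of_germ_eq ht
    rw [map_mul, map_one, res_res] at h3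
    exact ⟨W, _, hxW, IsUnit.of_mul_eq_one _ h3⟩
  · rw [← germ_res hW x hxW]
    exact h.map _

end MonoidalSpace

theorem MSpec.exists_basic {A : Type u} [CommMonoidWithZero A] {W : Set (MSpec A)} (hW : IsOpen W)
    {p : MSpec A} (hp : p ∈ W) : ∃ h : A, h ∉ p.carrier ∧ ∀ q : MSpec A, h ∉ q.carrier → q ∈ W := by
  induction hW with
  | basic s hs =>
    obtain ⟨h, rfl⟩ := hs
    exact ⟨h, hp, fun _ h => h⟩
  | univ => exact ⟨1, p.one_notMem, fun _ _ => trivial⟩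
  | inter s t _ _ hs ht =>
    obtain ⟨a, ha, ha'⟩ := hs hp.1
    obtain ⟨b, hb, hb'⟩ := ht hp.2
    refine ⟨a * b, fun h => (p.mem_or_mem _ _ h).elim ha hb, fun q hq => ⟨ha' q fun h => hq ?_,
      hb' q fun h => hq (q.mul_mem _ _ h)⟩⟩
    rw [mul_comm]
    exact q.mul_mem _ _ h
  | sUnion S _ ih =>
    obtain ⟨s, hs, hps⟩ := hp
    obtain ⟨h, h1, h2⟩ := ih s hs hps
    exact ⟨h, h1, fun q hq => ⟨s, hs, h2 q hq⟩⟩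

theorem MSpec.isOpen_basic {A : Type u} [CommMonoidWithZero A] (h : A) :
    IsOpen {p : MSpec A | h ∉ p.carrier} :=
  TopologicalSpace.isOpen_generateFrom_of_mem ⟨h, rfl⟩

theorem MSpec.pow_notMem {A : Type u} [CommMonoidWithZero A] {p : MSpec A} {h : A}
    (hp : h ∉ p.carrier) (n : ℕ) : h ^ n ∉ p.carrier := by
  induction n with
  | zero => rw [pow_zero]; exact p.one_notMem
  | succ n ih => rw [pow_succ]; exact fun h => (p.mem_or_mem _ _ h).elim ih hp

theorem MSpec.mem_mul_iff {A : Type u} [CommMonoidWithZero A] {p : MSpec A} {a b : A} :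
    a * b ∈ p.carrier ↔ a ∈ p.carrier ∨ b ∈ p.carrier :=
  ⟨p.mem_or_mem a b, fun h => h.elim (fun h => mul_comm b a ▸ p.mul_mem _ _ h) (p.mul_mem _ _)⟩

theorem MSpec.notMem_of_isUnit {A : Type u} [CommMonoidWithZero A] (p : MSpec A) {a : A}
    (ha : IsUnit a) : a ∉ p.carrier := by
  obtain ⟨b, hb⟩ := ha.exists_left_inv
  exact fun h => p.one_notMem (hb ▸ p.mul_mem b a h)

/-- The pullback of prime ideals, as a continuous map. -/
def MSpec.comap {A B : Type u} [CommMonoidWithZero A] [CommMonoidWithZero B] (f : A →*₀ B) :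
    C(MSpec B, MSpec A) where
  toFun p :=
    { carrier := f ⁻¹' p.carrier
      zero_mem := by simpa using p.zero_mem
      mul_mem := fun a x hx => by simpa using p.mul_mem _ _ hx
      one_notMem := by simpa using p.one_notMem
      mem_or_mem := fun a b h => p.mem_or_mem _ _ (by simpa using h) }
  continuous_toFun := by
    refine continuous_generateFrom_iff.2 ?_
    rintro _ ⟨a, rfl⟩
    exact MSpec.isOpen_basic (f a)

theorem MSpec.mem_comap {A B : Type u} [CommMonoidWithZero A] [CommMonoidWithZero B] {f : A →*₀ B}
    {p : MSpec B} {a : A} : a ∈ (MSpec.comap f p).carrier ↔ f a ∈ p.carrier := Iff.rfl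

/-- The unique closed point of `MSpec A`, for `A` with `0 ≠ 1`: the set of non-units. -/
def MSpec.closedPoint (A : Type u) [CommMonoidWithZero A] (h : (0 : A) ≠ 1) : MSpec A where
  carrier := {a | ¬ IsUnit a}
  zero_mem := fun h' => h ((isUnit_zero_iff).1 h')
  mul_mem a x hx := fun h' => hx (isUnit_of_mul_isUnit_right h')
  one_notMem := fun h => h isUnit_one
  mem_or_mem a b hab := by
    by_contra hc
    push Not at hc
    simp only [Set.mem_ofPred_eq, not_not] at hc
    exact hab (hc.1.mul hc.2)

/-- If `f : A → B` is a localization at the powers of `b`, the points of `MSpec B` are the points of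
the principal open `U_b` of `MSpec A`. -/
theorem MSpec.comap_localization {A B : Type u} [CommMonoidWithZero A] [CommMonoidWithZero B]
    (f : A →*₀ B) (b : A) (hf : (Submonoid.powers b).IsLocalizationMap f) :
    Topology.IsEmbedding (MSpec.comap f) ∧ Set.range (MSpec.comap f) = {p | b ∉ p.carrier} := by
  have hb : IsUnit (f b) := hf.map_units ⟨b, Submonoid.mem_powers b⟩
  have key : ∀ s : B, ∃ a, ∀ p : MSpec B, s ∈ p.carrier ↔ f a ∈ p.carrier := by
    intro s
    obtain ⟨⟨a, ⟨_, n, rfl⟩⟩, h⟩ := hf.surj s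
    refine ⟨a, fun p => ?_⟩
    simp only at h
    rw [← h, MSpec.mem_mul_iff, or_iff_left]
    rw [map_pow]
    exact p.notMem_of_isUnit (hb.pow n)
  refine ⟨⟨⟨?_⟩, fun p q h => ?_⟩, Set.ext fun p => ⟨?_, fun hp => ?_⟩⟩
  · refine le_antisymm (MSpec.comap f).continuous.le_induced ?_
    refine le_generateFrom ?_
    rintro _ ⟨s, rfl⟩
    obtain ⟨a, ha⟩ := key s
    exact ⟨_, MSpec.isOpen_basic a, Set.ext fun p => (ha p).not.symm⟩
  · ext s
    obtain ⟨a, ha⟩ := key s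
    rw [ha, ha, ← MSpec.mem_comap, h, MSpec.mem_comap]
  · rintro ⟨q, rfl⟩
    exact q.notMem_of_isUnit hb
  · have hp' : ∀ a a' : A, f a = f a' → (a ∈ p.carrier ↔ a' ∈ p.carrier) := by
      intro a a' h
      obtain ⟨⟨_, n, rfl⟩, h⟩ := hf.exists_of_eq h
      simp only at h
      have h1 := MSpec.pow_notMem hp n
      have := @MSpec.mem_mul_iff A _ p (b ^ n) a
      rw [h, MSpec.mem_mul_iff] at this
      tauto
    refine ⟨{ carrier := {s | ∃ a ∈ p.carrier, ∃ n : ℕ, s * f b ^ n = f a}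
              zero_mem := ⟨0, p.zero_mem, 0, by simp⟩
              mul_mem := ?_
              one_notMem := ?_
              mem_or_mem := ?_ }, ?_⟩
    · rintro s t ⟨a, ha, n, h⟩
      obtain ⟨⟨a', ⟨_, m, rfl⟩⟩, h'⟩ := hf.surj s
      simp only [map_pow] at h'
      refine ⟨a' * a, p.mul_mem _ _ ha, m + n, ?_⟩
      rw [map_mul, ← h, ← h', pow_add]
      exact mul_mul_mul_comm _ _ _ _
    · rintro ⟨a, ha, n, h⟩
      rw [one_mul, ← map_pow] at h
      exact MSpec.pow_notMem hp n ((hp' _ _ h).2 ha)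
    · rintro s t ⟨a, ha, n, h⟩
      obtain ⟨⟨a1, ⟨_, m, rfl⟩⟩, h1⟩ := hf.surj s
      obtain ⟨⟨a2, ⟨_, k, rfl⟩⟩, h2⟩ := hf.surj t
      simp only [map_pow] at h1 h2
      have : f (a1 * a2 * b ^ n) = f (a * b ^ (m + k)) := by
        simp only [map_mul, map_pow, ← h, ← h1, ← h2, pow_add]
        ac_rfl
      have h3 := (hp' _ _ this).2 (by rw [mul_comm]; exact p.mul_mem _ _ ha)
      rw [MSpec.mem_mul_iff, or_iff_left (MSpec.pow_notMem hp n), MSpec.mem_mul_iff] at h3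
      exact h3.imp (fun h => ⟨a1, h, m, h1⟩) (fun h => ⟨a2, h, k, h2⟩)
    · ext a
      refine ⟨?_, fun ha => ⟨a, ha, 0, by simp⟩⟩
      rintro ⟨a', ha, n, h⟩
      rw [← map_pow, ← map_mul] at h
      have h3 := (hp' _ _ h).2 ha
      rwa [MSpec.mem_mul_iff, or_iff_left (MSpec.pow_notMem hp n)] at h3

namespace MonoidalSpace

variable {X : MonoidalSpace.{u}}

/-- An isomorphism of the open subspace `U` of `X` with the affine monoid scheme `MSpec A`, whose
structure sheaf is the sheaf with sections `A[h⁻¹]` over the principal opens `U_h`, for `h ∈ A`: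
a homeomorphism `U ≃ MSpec A` and a morphism `A → Γ(U, O_X)` which identifies the sections of `O_X`
over the open set corresponding to `U_h` with `A[h⁻¹]`, for all `h ∈ A`. -/
structure AffineChart (U : Opens X) (A : Type u) [CommMonoidWithZero A] where
  homeo : U ≃ₜ MSpec A
  toSec : A →*₀ X.sec U
  isLocalizationMap : ∀ (h : A) (V : Opens X) (hV : V ≤ U),
    (∀ x : U, x.1 ∈ V ↔ h ∉ (homeo x).carrier) →
    (Submonoid.powers h).IsLocalizationMap (fun a => X.res hV (toSec a))

/-- An open subset `U` of `X` is affine if it is isomorphic to `MSpec A` for some `A`. -/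
def IsAffineOpen (U : Opens X) : Prop :=
  ∃ (A : Type u) (_ : CommMonoidWithZero A), Nonempty (AffineChart U A)

namespace AffineChart

variable {U : Opens X} {A : Type u} [CommMonoidWithZero A] (e : AffineChart U A)

/-- The open subset of `U` corresponding to the principal open `U_h`. -/
def basic (h : A) : Opens X :=
  ⟨(fun x : U => x.1) '' (e.homeo ⁻¹' {p | h ∉ p.carrier}),
    U.isOpen.isOpenMap_subtype_val _ ((MSpec.isOpen_basic h).preimage e.homeo.continuous)⟩

theorem mem_basic {h : A} {x : X} : x ∈ e.basic h ↔ ∃ hx : x ∈ U, h ∉ (e.homeo ⟨x, hx⟩).carrier :=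
  ⟨fun ⟨y, h1, h2⟩ => h2 ▸ ⟨y.2, h1⟩, fun ⟨hx, h⟩ => ⟨⟨x, hx⟩, h, rfl⟩⟩

theorem basic_le (h : A) : e.basic h ≤ U := fun _ hx => (e.mem_basic.1 hx).1

theorem basic_loc (h : A) :
    (Submonoid.powers h).IsLocalizationMap (fun a => X.res (e.basic_le h) (e.toSec a)) :=
  e.isLocalizationMap h _ _ fun x => by rw [mem_basic]; simp

theorem exists_basic {W : Opens X} {x : X} (hx : x ∈ W) (hxU : x ∈ U) :
    ∃ h : A, x ∈ e.basic h ∧ e.basic h ≤ W := by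
  obtain ⟨h, h1, h2⟩ := MSpec.exists_basic (W := e.homeo.symm ⁻¹' {y : U | y.1 ∈ W})
    ((W.isOpen.preimage continuous_subtype_val).preimage e.homeo.symm.continuous)
    (p := e.homeo ⟨x, hxU⟩) (by simpa using hx)
  refine ⟨h, e.mem_basic.2 ⟨hxU, h1⟩, fun y hy => ?_⟩
  obtain ⟨hyU, hy⟩ := e.mem_basic.1 hy
  simpa using h2 _ hy

theorem isUnit_germ_iff {x : X} (hx : x ∈ U) (a : A) :
    IsUnit (X.germ U x hx (e.toSec a)) ↔ a ∉ (e.homeo ⟨x, hx⟩).carrier := by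
  rw [MonoidalSpace.isUnit_germ_iff]
  refine ⟨fun ⟨W, hW, hxW, h⟩ ha => ?_, fun ha => ⟨e.basic a, e.basic_le a,
    e.mem_basic.2 ⟨hx, ha⟩, (e.basic_loc a).map_units ⟨a, Submonoid.mem_powers a⟩⟩⟩
  obtain ⟨b, hxb, hbW⟩ := e.exists_basic hxW hx
  have h' := h.map (X.res hbW)
  rw [res_res] at h'
  obtain ⟨t, ht⟩ := h'.exists_right_inv
  obtain ⟨⟨c, ⟨_, n, rfl⟩⟩, hc⟩ := (e.basic_loc b).surj t
  simp only at hc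
  have h2 : X.res (e.basic_le b) (e.toSec (a * c)) = X.res (e.basic_le b) (e.toSec (b ^ n)) := by
    rw [map_mul, map_mul, ← hc, ← mul_assoc, ht, one_mul]
  obtain ⟨⟨_, k, rfl⟩, h3⟩ := (e.basic_loc b).exists_of_eq h2
  simp only at h3
  obtain ⟨_, hb⟩ := e.mem_basic.1 hxb
  refine MSpec.pow_notMem (MSpec.pow_notMem hb k) 1 ?_
  have : b ^ k * b ^ n ∈ (e.homeo ⟨x, hx⟩).carrier := by
    rw [← h3, mul_comm a c, ← mul_assoc]
    exact MSpec.mul_mem _ _ _ ha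
  rw [MSpec.mem_mul_iff] at this
  rw [pow_one]
  exact this.resolve_right (MSpec.pow_notMem hb n)

section canon

variable {V : Opens X} (hV : V ≤ U) (b : A)

/-- The restriction of `A → Γ(U)` to `V`. -/
def resSec : A →*₀ X.sec V := (X.res hV).comp e.toSec

theorem resSec_loc (hb : ∀ x : U, x.1 ∈ V ↔ b ∉ (e.homeo x).carrier) :
    (Submonoid.powers b).IsLocalizationMap (e.resSec hV) :=
  e.isLocalizationMap b V hV hb

/-- The points of `V` as prime ideals of `A`. -/
def pts (y : V) : MSpec A := e.homeo ⟨y.1, hV y.2⟩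

theorem pts_embedding : Topology.IsEmbedding (e.pts hV) :=
  e.homeo.isEmbedding.comp (Topology.IsEmbedding.inclusion hV)

theorem range_pts (hb : ∀ x : U, x.1 ∈ V ↔ b ∉ (e.homeo x).carrier) :
    Set.range (e.pts hV) = {p | b ∉ p.carrier} := by
  ext p
  refine ⟨?_, fun hp => ?_⟩
  · rintro ⟨y, rfl⟩
    exact (hb _).1 y.2
  · have : e.homeo (e.homeo.symm p) = p := by simp
    exact ⟨⟨(e.homeo.symm p).1, (hb _).2 (by rw [this]; exact hp)⟩, this⟩

variable (hb : ∀ x : U, x.1 ∈ V ↔ b ∉ (e.homeo x).carrier)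

/-- The points of the principal open subset `V` of `U` are the prime ideals of `Γ(V)`. -/
def canonHomeo : V ≃ₜ MSpec (X.sec V) :=
  ((e.pts_embedding hV).toHomeomorph.trans (Homeomorph.setCongr ((e.range_pts hV b hb).trans
    (MSpec.comap_localization _ b (e.resSec_loc hV b hb)).2.symm))).trans
    (MSpec.comap_localization _ b (e.resSec_loc hV b hb)).1.toHomeomorph.symm

theorem comap_canonHomeo (y : V) :
    MSpec.comap (e.resSec hV) (e.canonHomeo hV b hb y) = e.pts hV y := by
  have h := (MSpec.comap_localization _ b (e.resSec_loc hV b hb)).1.toHomeomorph.apply_symm_apply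
    (Homeomorph.setCongr ((e.range_pts hV b hb).trans
    (MSpec.comap_localization _ b (e.resSec_loc hV b hb)).2.symm)
      ((e.pts_embedding hV).toHomeomorph y))
  exact congrArg Subtype.val h

/-- A principal open subset of an affine open subset is affine. -/
def canon : AffineChart V (X.sec V) where
  homeo := e.canonHomeo hV b hb
  toSec := MonoidWithZeroHom.id _
  isLocalizationMap s W hW hs := by
    have hf := e.resSec_loc hV b hb
    have hbu : IsUnit (e.resSec hV b) := hf.map_units ⟨b, Submonoid.mem_powers b⟩
    obtain ⟨⟨a, ⟨_, n, rfl⟩⟩, ha⟩ := hf.surj s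
    simp only [map_pow] at ha
    have hW' : (Submonoid.powers (a * b)).IsLocalizationMap
        (fun a => X.res (hW.trans hV) (e.toSec a)) := by
      refine e.isLocalizationMap _ _ _ fun x => ?_
      rw [MSpec.mem_mul_iff, not_or]
      refine ⟨fun hx => ?_, fun ⟨h1, h2⟩ => ?_⟩
      · have hxV := hW hx
        refine ⟨fun h => ?_, (hb x).1 hxV⟩
        have h2 := (hs ⟨x.1, hxV⟩).1 hx
        have h3 : a ∈ (e.pts hV ⟨x.1, hxV⟩).carrier := h
        rw [← e.comap_canonHomeo hV b hb, MSpec.mem_comap, ← ha, MSpec.mem_mul_iff] at h3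
        exact h3.elim h2 (MSpec.notMem_of_isUnit _ (hbu.pow n))
      · have hxV := (hb x).2 h2
        refine (hs ⟨x.1, hxV⟩).2 fun h => h1 ?_
        change a ∈ (e.pts hV ⟨x.1, hxV⟩).carrier
        rw [← e.comap_canonHomeo hV b hb, MSpec.mem_comap, ← ha, MSpec.mem_mul_iff]
        exact .inl h
    have hres : ∀ c : A, X.res (hW.trans hV) (e.toSec c) = X.res hW (e.resSec hV c) :=
      fun c => (X.res_res _ _ _).symm
    simp only [hres] at hW'
    obtain ⟨d, hd⟩ := hbu.exists_right_inv
    have hs' : e.resSec hV a * d ^ n = s := by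
      rw [← ha, mul_assoc, ← mul_pow, hd, one_pow, mul_one]
    refine ⟨?_, fun t => ?_, fun {s1 s2} h => ?_⟩
    · rintro ⟨_, k, rfl⟩
      have h1 := hW'.map_units ⟨a * b, Submonoid.mem_powers _⟩
      simp only [map_mul] at h1
      simp only [MonoidWithZeroHom.id_apply, map_pow, ← hs', map_mul]
      refine IsUnit.pow _ ((isUnit_of_mul_isUnit_left h1).mul (IsUnit.pow _ (IsUnit.map _ ?_)))
      exact IsUnit.of_mul_eq_one _ (by rw [mul_comm]; exact hd)
    · obtain ⟨⟨c, ⟨_, k, rfl⟩⟩, hc⟩ := hW'.surj t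
      refine ⟨⟨e.resSec hV c * d ^ k * d ^ (n * k), ⟨_, k, rfl⟩⟩, ?_⟩
      simp only [map_mul, map_pow, MonoidWithZeroHom.id_apply] at hc ⊢
      rw [← hc, ← hs', map_mul, map_pow]
      have hd' : X.res hW (e.resSec hV b) ^ k * X.res hW d ^ k = 1 := by
        rw [← mul_pow, ← map_mul, hd, map_one, one_pow]
      calc t * (X.res hW (e.resSec hV a) * X.res hW d ^ n) ^ k
          = t * X.res hW (e.resSec hV a) ^ k * X.res hW d ^ (n * k) * 1 := by
            rw [mul_pow, ← pow_mul, mul_one, mul_assoc]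
        _ = _ := by
            rw [← hd', mul_pow]
            generalize X.res hW (e.resSec hV a) ^ k = x, X.res hW (e.resSec hV b) ^ k = y,
              X.res hW d ^ (n * k) = z, X.res hW d ^ k = w
            ac_rfl
    · simp only [MonoidWithZeroHom.id_apply] at h
      obtain ⟨⟨a1, ⟨_, m1, rfl⟩⟩, h1⟩ := hf.surj s1
      obtain ⟨⟨a2, ⟨_, m2, rfl⟩⟩, h2⟩ := hf.surj s2
      simp only [map_pow] at h1 h2
      have h3 : X.res hW (e.resSec hV (a1 * b ^ m2)) = X.res hW (e.resSec hV (a2 * b ^ m1)) := by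
        simp only [map_mul, map_pow, ← h1, ← h2, h]
        ac_rfl
      obtain ⟨⟨_, k, rfl⟩, h4⟩ := hW'.exists_of_eq h3
      have h5 := congrArg (e.resSec hV) h4
      simp only [map_mul, map_pow, ← h1, ← h2, ← ha] at h5
      refine ⟨⟨s ^ k, k, rfl⟩, ?_⟩
      simp only
      have hu : IsUnit ((e.resSec hV b ^ n) ^ k * e.resSec hV b ^ k * e.resSec hV b ^ m1
          * e.resSec hV b ^ m2) :=
        ((((hbu.pow n).pow k).mul (hbu.pow k)).mul (hbu.pow m1)).mul (hbu.pow m2)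
      refine hu.mul_right_cancel ?_
      simp only [mul_pow] at h5
      generalize (e.resSec hV b ^ n) ^ k = x, e.resSec hV b ^ k = y,
        e.resSec hV b ^ m1 = z, e.resSec hV b ^ m2 = w, s ^ k = v at h5 ⊢
      convert h5 using 1 <;> ac_rfl

theorem canon_isUnit_germ_iff (y : V) (s : X.sec V) :
    IsUnit (X.germ V y.1 y.2 s) ↔ s ∉ (e.canonHomeo hV b hb y).carrier :=
  (e.canon hV b hb).isUnit_germ_iff y.2 s

end canon

end AffineChart

/-- The affine open subsets of `X`, ordered by inclusion. -/
abbrev AffineOpens (X : MonoidalSpace.{u}) : Type u := {U : Opens X // IsAffineOpen U}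

namespace AffineOpens

/-- The pointed monoid `Γ U` of sections over an affine open subset. -/
abbrev sec (U : AffineOpens X) : Type u := X.sec U.1

/-- The restriction `Γ V → Γ U`. -/
abbrev res {U V : AffineOpens X} (h : U ≤ V) : V.sec →*₀ U.sec := X.res h

theorem exists_chart (U : AffineOpens X) : ∃ e : AffineChart U.1 U.sec,
    e.toSec = MonoidWithZeroHom.id _ := by
  obtain ⟨U, A, _, ⟨e⟩⟩ := U
  exact ⟨e.canon le_rfl 1 fun x => ⟨fun _ => MSpec.one_notMem _, fun _ => x.2⟩, rfl⟩

/-- An affine open subset `U` of `X` is isomorphic to `MSpec (Γ U)`. -/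
def chart (U : AffineOpens X) : AffineChart U.1 U.sec := U.exists_chart.choose

theorem chart_toSec (U : AffineOpens X) : U.chart.toSec = MonoidWithZeroHom.id _ :=
  U.exists_chart.choose_spec

/-- The identification of `U` with `MSpec (Γ U)` sends a point to the ideal of sections
which are not invertible in the stalk at that point. -/
theorem mem_chart_iff (U : AffineOpens X) (x : U.1) (s : U.sec) :
    s ∈ (U.chart.homeo x).carrier ↔ ¬ IsUnit (X.germ U.1 x.1 x.2 s) := by
  have h := U.chart.isUnit_germ_iff x.2 s
  rw [chart_toSec] at h
  rw [← not_iff_not, not_not]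
  exact h.symm

/-- The inclusion `MSpec (Γ U) ≃ U ⊆ X`. -/
def point (U : AffineOpens X) : C(MSpec U.sec, X) where
  toFun p := (U.chart.homeo.symm p).1
  continuous_toFun := continuous_subtype_val.comp U.chart.homeo.symm.continuous

theorem point_mem (U : AffineOpens X) (p : MSpec U.sec) : U.point p ∈ U.1 :=
  (U.chart.homeo.symm p).2

theorem mem_iff (U : AffineOpens X) (p : MSpec U.sec) (s : U.sec) :
    s ∈ p.carrier ↔ ¬ IsUnit (X.germ U.1 (U.point p) (U.point_mem p) s) := by
  rw [← U.mem_chart_iff ⟨_, U.point_mem p⟩]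
  simp [point]

theorem eq_point_iff (U : AffineOpens X) (p : MSpec U.sec) (x : X) (hx : x ∈ U.1) :
    U.point p = x ↔ ∀ s : U.sec, s ∈ p.carrier ↔ ¬ IsUnit (X.germ U.1 x hx s) := by
  refine ⟨fun h => ?_, fun h => ?_⟩
  · subst h
    exact U.mem_iff p
  · have : p = U.chart.homeo ⟨x, hx⟩ := by
      ext s
      rw [U.mem_chart_iff, h]
    simp [point, this]

theorem point_comap {U V : AffineOpens X} (h : U ≤ V) (p : MSpec U.sec) :
    V.point (MSpec.comap (res h) p) = U.point p := by
  refine (V.eq_point_iff _ _ (h (U.point_mem p))).2 fun s => ?_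
  rw [MSpec.mem_comap, U.mem_iff, germ_res]

/-- An inclusion of affine open subsets is the inclusion of a principal open subset. -/
theorem exists_loc {U V : AffineOpens X} (h : U ≤ V) :
    ∃ a : V.sec, (Submonoid.powers a).IsLocalizationMap (res h) := by
  have hV : ∀ s, V.chart.toSec s = s := fun s => by rw [chart_toSec]; rfl
  suffices ∃ a : V.sec, ∀ x : V.1, x.1 ∈ U.1 ↔ a ∉ (V.chart.homeo x).carrier by
    obtain ⟨a, ha⟩ := this
    refine ⟨a, ?_⟩
    have := V.chart.isLocalizationMap a U.1 h ha
    simp only [hV] at this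
    exact this
  by_cases hU : (0 : U.sec) = 1
  · refine ⟨0, fun x => ⟨fun hx => ?_, fun hx => (hx (MSpec.zero_mem _)).elim⟩⟩
    have := U.chart.homeo ⟨x.1, hx⟩
    exact (this.one_notMem (hU ▸ this.zero_mem)).elim
  · let p := MSpec.closedPoint U.sec hU
    obtain ⟨a, h1, h2⟩ := V.chart.exists_basic (W := U.1) (U.point_mem p) (h (U.point_mem p))
    refine ⟨a, fun x => ⟨fun hx => ?_, fun hx => h2 (V.chart.mem_basic.2 ⟨x.2, hx⟩)⟩⟩
    obtain ⟨b, h3, h4⟩ := U.chart.exists_basic (W := V.chart.basic a) h1 (U.point_mem p)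
    have hb : IsUnit b := by
      obtain ⟨h5, h6⟩ := U.chart.mem_basic.1 h3
      have h7 : U.chart.homeo ⟨U.point p, h5⟩ = p := by simp [point]
      rw [h7] at h6
      exact not_not.1 h6
    exact (V.chart.mem_basic.1 (h4 (U.chart.mem_basic.2
      ⟨hx, MSpec.notMem_of_isUnit _ hb⟩))).2

/-- Affine open subsets form a basis of the topology of an affine open subset. -/
theorem exists_le (V : AffineOpens X) {W : Opens X} {x : X} (hxV : x ∈ V.1) (hx : x ∈ W) :
    ∃ U : AffineOpens X, U ≤ V ∧ U.1 ≤ W ∧ x ∈ U.1 := by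
  obtain ⟨a, h1, h2⟩ := V.chart.exists_basic hx hxV
  exact ⟨⟨V.chart.basic a, _, _, ⟨V.chart.canon (V.chart.basic_le a) a fun x => by
    rw [V.chart.mem_basic]; simp⟩⟩, V.chart.basic_le a, h2, h1⟩

end AffineOpens

end MonoidalSpace

/-- A monoid scheme: a monoidal space with an open covering by affine monoid schemes. -/
structure MonoidScheme extends MonoidalSpace.{u} where
  exists_affine : ∀ x : carrier, ∃ U : MonoidalSpace.AffineOpens toMonoidalSpace, x ∈ U.1

instance : CoeSort MonoidScheme.{u} (Type u) := ⟨fun X => X.carrier⟩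

section baseExtension

/-- The base extension `A_R = R[A] / ⟨1_R 0_A⟩` of a pointed monoid `A` to a ring `R`. -/
abbrev BaseExt (R A : Type u) [CommRing R] [CommMonoidWithZero A] : Type u :=
  MonoidAlgebra R A ⧸ Ideal.span {(MonoidAlgebra.single 0 1 : MonoidAlgebra R A)}

namespace BaseExt

variable (R : Type u) [CommRing R] {A B : Type u} [CommMonoidWithZero A] [CommMonoidWithZero B]

/-- The morphism of pointed monoids `A → A_R^•`, `a ↦ 1_R a`. -/
def of : A →*₀ BaseExt R A where
  toFun a := Ideal.Quotient.mk _ (MonoidAlgebra.single a 1)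
  map_zero' := Ideal.Quotient.eq_zero_iff_mem.2 (Ideal.subset_span rfl)
  map_one' := rfl
  map_mul' a b := by rw [← map_mul, MonoidAlgebra.single_mul_single, one_mul]

variable {R}

/-- The adjunction: a morphism of pointed monoids `A → S^•` induces `A_R → S`. -/
def lift {S : Type u} [CommRing S] (i : R →+* S) (f : A →*₀ S) : BaseExt R A →+* S :=
  Ideal.Quotient.lift _ (MonoidAlgebra.liftNCRingHom i (f : A →* S) fun _ _ => Commute.all _ _) (by
    intro x hx
    have : Ideal.span {(MonoidAlgebra.single 0 1 : MonoidAlgebra R A)} ≤ RingHom.ker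
        (MonoidAlgebra.liftNCRingHom i (f : A →* S) fun _ _ => Commute.all _ _) := by
      rw [Ideal.span_singleton_le_iff_mem, RingHom.mem_ker]
      simp [MonoidAlgebra.liftNCRingHom]
    exact this hx)

@[simp] theorem lift_of {S : Type u} [CommRing S] (i : R →+* S) (f : A →*₀ S) (a : A) :
    lift i f (of R a) = f a := by
  change MonoidAlgebra.liftNC (i : R →+ S) f (MonoidAlgebra.single a 1) = f a
  simp

@[simp] theorem lift_algebraMap {S : Type u} [CommRing S] (i : R →+* S) (f : A →*₀ S) (r : R) :
    lift i f (algebraMap R _ r) = i r := by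
  change lift i f (Ideal.Quotient.mk _ (algebraMap R (MonoidAlgebra R A) r)) = i r
  simp [lift, MonoidAlgebra.liftNCRingHom]

theorem ringHom_ext {S : Type u} [CommRing S] {f g : BaseExt R A →+* S}
    (h1 : ∀ r, f (algebraMap R _ r) = g (algebraMap R _ r)) (h2 : ∀ a, f (of R a) = g (of R a)) :
    f = g := by
  refine Ideal.Quotient.ringHom_ext (MonoidAlgebra.ringHom_ext (fun r => ?_) fun a => h2 a)
  exact h1 r

/-- Functoriality of `A ↦ A_R`. -/
def map (f : A →*₀ B) : BaseExt R A →+* BaseExt R B :=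
  lift (algebraMap R _) ((of R).comp f)

@[simp] theorem map_of (f : A →*₀ B) (a : A) : map f (of R a) = of R (f a) := by simp [map]

@[simp] theorem map_algebraMap (f : A →*₀ B) (r : R) :
    map f (algebraMap R _ r) = algebraMap R (BaseExt R B) r := by simp [map]

/-- Base extension commutes with localization. -/
theorem isLocalization_map (f : A →*₀ B) (h : A) (hf : (Submonoid.powers h).IsLocalizationMap f) :
    let _ := (map (R := R) f).toAlgebra
    IsLocalization.Away (of R h) (BaseExt R B) := by
  let _ := (map (R := R) f).toAlgebra
  have hmap : ∀ x, algebraMap (BaseExt R A) (BaseExt R B) x = map f x := fun x => rfl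
  let L := Localization.Away (of R h)
  let f' : (Submonoid.powers h).LocalizationMap B := ⟨(f : A →* B).toMulHom, hf⟩
  have hfu : IsUnit (f h) := hf.map_units ⟨h, Submonoid.mem_powers h⟩
  have hu : IsUnit (algebraMap (BaseExt R A) (BaseExt R B) (of R h)) := by
    rw [hmap, map_of]; exact hfu.map _
  let g : A →*₀ L := (algebraMap (BaseExt R A) L).toMonoidWithZeroHom.comp (of R)
  have hgu : IsUnit (g h) := IsLocalization.Away.algebraMap_isUnit (S := L) (of R h)
  have hg : ∀ y : Submonoid.powers h, IsUnit (g y) := by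
    rintro ⟨_, n, rfl⟩
    simpa using hgu.pow n
  let g0 : B →*₀ L := f'.lift₀ g hg
  have hg0 : ∀ a, g0 (f a) = g a := fun a => f'.lift_eq (g := (g : A →* L)) hg a
  let inv : BaseExt R B →+* L := lift (algebraMap R L) g0
  let dir : L →+* BaseExt R B := IsLocalization.Away.lift (of R h) hu
  have hdir : ∀ x, dir (algebraMap _ _ x) = map f x := fun x => IsLocalization.Away.lift_eq _ hu x
  have h1 : ∀ x, inv (map f x) = algebraMap _ L x := by
    intro x
    have : inv.comp (map f) = algebraMap (BaseExt R A) L :=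
      ringHom_ext (fun r => by
        simp only [RingHom.comp_apply, map_algebraMap, inv, lift_algebraMap]
        rw [IsScalarTower.algebraMap_apply R (BaseExt R A) L])
        fun a => by simp [inv, hg0, g]
    exact congrArg (fun k : BaseExt R A →+* L => k x) this
  have h2 : ∀ z, dir (inv z) = z := by
    intro x
    have : dir.comp inv = RingHom.id _ :=
      ringHom_ext (fun r => by
        simp only [RingHom.comp_apply, inv, lift_algebraMap]
        rw [IsScalarTower.algebraMap_apply R (BaseExt R A) L, hdir, map_algebraMap]; rfl)
        fun b => by
          obtain ⟨⟨a, ⟨_, n, rfl⟩⟩, ha⟩ := hf.surj b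
          simp only [map_pow] at ha
          simp only [RingHom.comp_apply, inv, lift_of, RingHom.id_apply]
          have hb := congrArg (fun b => dir (g0 b)) ha
          simp only [map_mul, map_pow, hg0, g, MonoidWithZeroHom.comp_apply] at hb
          have hb' := congrArg (of R) ha
          simp only [map_mul, map_pow] at hb'
          have h3 : ∀ x, dir ((algebraMap (BaseExt R A) L).toMonoidWithZeroHom (of R x))
              = of R (f x) := fun x => (hdir _).trans (map_of _ _)
          rw [h3, h3, ← hb'] at hb
          exact ((hfu.map (of R)).pow n).mul_right_cancel hb
    exact congrArg (fun k : BaseExt R B →+* BaseExt R B => k x) this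
  refine ⟨?_, fun z => ?_, fun {x y} h => ?_⟩
  · rintro ⟨_, n, rfl⟩
    simpa using hu.pow n
  · obtain ⟨⟨a, s⟩, h⟩ := IsLocalization.surj (Submonoid.powers (of R h)) (inv z)
    refine ⟨⟨a, s⟩, ?_⟩
    have := congrArg dir h
    rwa [map_mul, h2, hdir, hdir] at this
  · have := congrArg inv h
    rw [hmap, hmap, h1, h1] at this
    exact IsLocalization.exists_of_eq this

end BaseExt

end baseExtension

section spec

variable {A S : Type u} [CommMonoidWithZero A] [CommRing S]

/-- The congruence kernel `{(a, b) | f a = f b}` of a morphism of pointed monoids. -/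
def congker {B : Type u} [CommMonoidWithZero B] (f : A →*₀ B) : Con A := Con.ker f

/-- The injection `A / congker f → B`. -/
def congkerLift {B : Type u} [CommMonoidWithZero B] (f : A →*₀ B) : (congker f).Quotient →*₀ B where
  toFun := fun q => Con.liftOn q f fun _ _ h => h
  map_zero' := map_zero f
  map_one' := map_one f
  map_mul' x y := by
    induction x, y using Con.induction_on₂ with
    | H x y => exact map_mul f x y

theorem congkerLift_injective {B : Type u} [CommMonoidWithZero B] (f : A →*₀ B) :
    Function.Injective (congkerLift f) := by
  intro x y h
  induction x, y using Con.induction_on₂ with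
  | H x y => exact (Con.eq _).2 h

/-- The morphism `A → S^• → (S / 𝔭)^•`. -/
def toQuotient (f : A →*₀ S) (p : PrimeSpectrum S) : A →*₀ S ⧸ p.asIdeal :=
  (Ideal.Quotient.mk p.asIdeal).toMonoidWithZeroHom.comp f

/-- The continuous map `Spec S → SCong A` induced by a morphism `A → S^•`, sending a prime ideal `𝔭`
to the congruence kernel of `A → (S / 𝔭)^•`. -/
def specToSCong (f : A →*₀ S) : C(PrimeSpectrum S, SCong A) where
  toFun p := ⟨congker (toQuotient f p), FractionRing (S ⧸ p.asIdeal), inferInstance,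
    (algebraMap (S ⧸ p.asIdeal) (FractionRing (S ⧸ p.asIdeal))).toMonoidWithZeroHom.comp
      (congkerLift (toQuotient f p)),
    (IsFractionRing.injective (S ⧸ p.asIdeal) (FractionRing (S ⧸ p.asIdeal))).comp
      (congkerLift_injective _)⟩
  continuous_toFun := by
    refine continuous_induced_rng.2 (continuous_generateFrom_iff.2 ?_)
    rintro _ ⟨a, b, rfl⟩
    convert (PrimeSpectrum.basicOpen (f a - f b)).isOpen using 1
    ext p
    exact (Ideal.Quotient.eq (I := p.asIdeal)).not

/-- The continuous map `Spec S → MSpec A` induced by a morphism `A → S^•`, `𝔭 ↦ f⁻¹(𝔭)`. -/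
def specToMSpec (f : A →*₀ S) : C(PrimeSpectrum S, MSpec A) where
  toFun p :=
    { carrier := {a | f a ∈ p.asIdeal}
      zero_mem := by simp
      mul_mem := fun a x hx => by
        simp only [Set.mem_ofPred_eq, map_mul] at hx ⊢
        exact Ideal.mul_mem_left _ _ hx
      one_notMem := by
        simp only [Set.mem_ofPred_eq, map_one]
        exact (Ideal.ne_top_iff_one _).1 p.isPrime.ne_top
      mem_or_mem := fun a b h => p.isPrime.mem_or_mem (by simpa using h) }
  continuous_toFun := by
    refine continuous_generateFrom_iff.2 ?_
    rintro _ ⟨a, rfl⟩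
    exact (PrimeSpectrum.basicOpen (f a)).isOpen

theorem nullIdeal_specToSCong (f : A →*₀ S) (p : PrimeSpectrum S) :
    Cong.nullIdeal A (specToSCong f p).toCong = specToMSpec f p := by
  ext a
  refine (Ideal.Quotient.eq (I := p.asIdeal) (x := f a) (y := f 0)).trans ?_
  rw [map_zero, sub_zero]
  rfl

end spec

namespace MonoidScheme

open MonoidalSpace

variable (X : MonoidScheme.{u})

/-- The affine open subsets of a monoid scheme, ordered by inclusion. -/
abbrev Affines : Type u := AffineOpens X.toMonoidalSpace

/-- The diagram of the spaces `Cong (Γ U)`, for `U` affine open in `X`. -/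
def congDiagram : X.Affines ⥤ TopCat.{u} where
  obj U := TopCat.of (Cong U.sec)
  map f := TopCat.ofHom (Cong.comap (AffineOpens.res f.le))
  map_id U := by
    ext c
    refine Subtype.ext (Con.ext fun a b => ?_)
    change c.1 (X.res _ a) (X.res _ b) ↔ c.1 a b
    rw [X.res_refl, X.res_refl]
  map_comp {U V W} f g := by
    ext c
    refine Subtype.ext (Con.ext fun a b => ?_)
    change c.1 (X.res _ a) (X.res _ b) ↔ c.1 (X.res f.le (X.res g.le a)) (X.res f.le (X.res g.le b))
    rw [X.res_res, X.res_res]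

/-- The congruence space `X^cong` of a monoid scheme. -/
def CongSpace : TopCat.{u} := colimit X.congDiagram

/-- The map `Cong (Γ U) → X^cong`. -/
def congι (U : X.Affines) : C(Cong U.sec, X.CongSpace) := (colimit.ι X.congDiagram U).hom

/-- The diagram of the spaces `SCong (Γ U)`, for `U` affine open in `X`. -/
def scongDiagram : X.Affines ⥤ TopCat.{u} where
  obj U := TopCat.of (SCong U.sec)
  map f := TopCat.ofHom (SCong.comap (AffineOpens.res f.le))
  map_id U := by
    ext c
    refine Subtype.ext (Con.ext fun a b => ?_)
    change c.1 (X.res _ a) (X.res _ b) ↔ c.1 a b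
    rw [X.res_refl, X.res_refl]
  map_comp {U V W} f g := by
    ext c
    refine Subtype.ext (Con.ext fun a b => ?_)
    change c.1 (X.res _ a) (X.res _ b) ↔ c.1 (X.res f.le (X.res g.le a)) (X.res f.le (X.res g.le b))
    rw [X.res_res, X.res_res]

/-- The strong congruence space `SCong X` of a monoid scheme. -/
def SCongSpace : TopCat.{u} := colimit X.scongDiagram

/-- The map `SCong (Γ U) → SCong X`. -/
def scongι (U : X.Affines) : C(SCong U.sec, X.SCongSpace) := (colimit.ι X.scongDiagram U).hom

/-- The inclusions `SCong (Γ U) → Cong (Γ U)`. -/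
def scongDiagramIncl : X.scongDiagram ⟶ X.congDiagram where
  app _ := TopCat.ofHom ⟨SCong.toCong, continuous_induced_dom⟩
  naturality _ _ _ := rfl

/-- The natural inclusion `SCong X → X^cong`. -/
def scongIncl : C(X.SCongSpace, X.CongSpace) := (colimMap X.scongDiagramIncl).hom

theorem scongIncl_scongι (U : X.Affines) (c : SCong U.sec) :
    X.scongIncl (X.scongι U c) = X.congι U c.toCong :=
  congrArg (fun f => f.hom c) (ι_colimMap X.scongDiagramIncl U)

/-- The maps `Cong (Γ U) → U ⊆ X`, sending a prime congruence to the point of `U` given by its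
null ideal. -/
def congCocone : Cocone X.congDiagram where
  pt := TopCat.of X
  ι :=
    { app := fun U => TopCat.ofHom ((AffineOpens.point U).comp (Cong.nullIdeal U.sec))
      naturality := fun {_ V} f => by
        ext c
        refine Eq.trans ?_ (AffineOpens.point_comap f.le (Cong.nullIdeal _ c))
        refine congrArg (AffineOpens.point V) (MSpec.ext (Set.ext fun a => ?_))
        change c.1 (X.res _ a) (X.res _ 0) ↔ c.1 (X.res _ a) 0
        rw [map_zero] }

/-- The projection `π_X : X^cong → X`. -/
def congProj : C(X.CongSpace, X) := (colimit.desc X.congDiagram X.congCocone).hom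

theorem congProj_congι (U : X.Affines) (c : Cong U.sec) :
    X.congProj (X.congι U c) = AffineOpens.point U (Cong.nullIdeal U.sec c) :=
  congrArg (fun f : X.congDiagram.obj U ⟶ TopCat.of X => f.hom c)
    (colimit.ι_desc X.congCocone U)

/-- The congruence `𝔠_x` on the stalk of `X` at `π_X(x)`, for a point `x` of `X^cong`: it is
generated by the push-forwards, along `Γ U → O_{X, π_X(x)}`, of the prime congruences on `Γ U`
which correspond to `x`, for all affine open neighbourhoods `U` of `π_X(x)`. -/
def stalkCon (x : X.CongSpace) : Con (X.Stalk (X.congProj x)) :=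
  conGen fun s t => ∃ (U : X.Affines) (hU : X.congProj x ∈ U.1) (c : Cong U.sec),
    X.congι U c = x ∧ ∃ a b : U.sec, c.1 a b ∧
      s = X.germ U.1 (X.congProj x) hU a ∧ t = X.germ U.1 (X.congProj x) hU b

/-- The residue pointed group `κ(x) = O_{X, π_X(x)} / 𝔠_x` of a point `x` of `X^cong`. -/
abbrev CongResidue (x : X.CongSpace) : Type u := (X.stalkCon x).Quotient

/-- The projection `O_{X, π_X(x)} → κ(x)`. -/
def congResidueMk (x : X.CongSpace) : X.Stalk (X.congProj x) →*₀ X.CongResidue x :=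
  conMk (X.stalkCon x)

variable (R : Type u) [CommRing R]

/-- The diagram of the affine schemes `U_R = Spec ((Γ U)_R)`, for `U` affine open in `X`. -/
def realizationDiagram : X.Affines ⥤ Scheme.{u} where
  obj U := Spec (CommRingCat.of (BaseExt R U.sec))
  map f := Spec.map (CommRingCat.ofHom (BaseExt.map (AffineOpens.res f.le)))
  map_id U := by
    rw [← Spec.map_id]
    congr 1
    ext1
    exact BaseExt.ringHom_ext (fun r => by simp) fun a => by simp [X.res_refl]
  map_comp f g := by
    rw [← Spec.map_comp]
    congr 1
    ext1
    exact BaseExt.ringHom_ext (fun r => by simp) fun a => by simp [X.res_res]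

instance {U V : X.Affines} (f : U ⟶ V) : IsOpenImmersion ((X.realizationDiagram R).map f) := by
  obtain ⟨a, ha⟩ := AffineOpens.exists_loc f.le
  let _ := (BaseExt.map (R := R) (AffineOpens.res f.le)).toAlgebra
  have := BaseExt.isLocalization_map (R := R) _ a ha
  exact IsOpenImmersion.of_isLocalization (BaseExt.of R a)

/-- The map `U_R → X` sending `𝔭` to the point of `U` given by the prime ideal `𝔭 ∩ Γ U`. -/
def specPoint (U : X.Affines) : C(PrimeSpectrum (BaseExt R U.sec), X) :=
  (AffineOpens.point U).comp (specToMSpec (BaseExt.of R))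

theorem specPoint_mem (U : X.Affines) (p : PrimeSpectrum (BaseExt R U.sec)) :
    X.specPoint R U p ∈ U.1 := AffineOpens.point_mem U _

variable {X R} in
theorem specPoint_map {U V : X.Affines} (f : U ⟶ V) (p : PrimeSpectrum (BaseExt R U.sec)) :
    X.specPoint R V ((X.realizationDiagram R).map f p) = X.specPoint R U p := by
  refine Eq.trans ?_ (AffineOpens.point_comap f.le (specToMSpec (BaseExt.of R) p))
  refine congrArg (AffineOpens.point V) (MSpec.ext (Set.ext fun a => ?_))
  change BaseExt.map _ (BaseExt.of R a) ∈ p.asIdeal ↔ BaseExt.of R (X.res f.le a) ∈ p.asIdeal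
  rw [BaseExt.map_of]

variable {X R} in
/-- If `p ∈ V_R` lies over a point of `U ⊆ V`, then `p ∈ U_R`. -/
theorem exists_preimage {U V : X.Affines} (f : U ⟶ V) (p : PrimeSpectrum (BaseExt R V.sec))
    (hp : X.specPoint R V p ∈ U.1) :
    ∃ q : PrimeSpectrum (BaseExt R U.sec), (X.realizationDiagram R).map f q = p := by
  obtain ⟨a, ha⟩ := AffineOpens.exists_loc f.le
  let _ := (BaseExt.map (R := R) (AffineOpens.res f.le)).toAlgebra
  have := BaseExt.isLocalization_map (R := R) _ a ha
  have h := PrimeSpectrum.localization_away_comap_range (BaseExt R U.sec) (BaseExt.of R a)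
  have hp' : p ∈ (PrimeSpectrum.basicOpen (BaseExt.of R a) : Set _) := by
    intro (h1 : a ∈ (specToMSpec (BaseExt.of R) p).carrier)
    refine (AffineOpens.mem_iff V (specToMSpec (BaseExt.of R) p) a).1 h1 ?_
    exact germ_res f.le _ hp a ▸ (ha.map_units ⟨a, Submonoid.mem_powers a⟩).map (X.germ U.1 _ hp)
  rw [← h] at hp'
  exact hp'

variable {X R} in
theorem exists_common_preimage {U V W : X.Affines} (f : U ⟶ W) (g : V ⟶ W)
    (p : PrimeSpectrum (BaseExt R U.sec)) (q : PrimeSpectrum (BaseExt R V.sec))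
    (h : (X.realizationDiagram R).map f p = (X.realizationDiagram R).map g q) :
    ∃ (Y : X.Affines) (f' : Y ⟶ U) (g' : Y ⟶ V) (r : PrimeSpectrum (BaseExt R Y.sec)),
      (X.realizationDiagram R).map f' r = p ∧ (X.realizationDiagram R).map g' r = q := by
  have h1 : X.specPoint R U p = X.specPoint R V q :=
    (specPoint_map f p).symm.trans ((congrArg (X.specPoint R W) h).trans (specPoint_map g q))
  obtain ⟨Y, hYU, hYV, hY⟩ := AffineOpens.exists_le U (X.specPoint_mem R U p)
    (W := V.1) (h1 ▸ X.specPoint_mem R V q)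
  have hYV' : Y ≤ V := hYV
  obtain ⟨r, hr⟩ := exists_preimage (homOfLE hYU) p hY
  refine ⟨Y, homOfLE hYU, homOfLE hYV', r, hr, ?_⟩
  refine ((X.realizationDiagram R).map g).isOpenEmbedding.injective ?_
  refine Eq.trans ?_ ((congrArg ((X.realizationDiagram R).map f) hr).trans h)
  have h2 : (X.realizationDiagram R).map (homOfLE hYV') ≫ (X.realizationDiagram R).map g =
      (X.realizationDiagram R).map (homOfLE hYU) ≫ (X.realizationDiagram R).map f := by
    rw [← Functor.map_comp, ← Functor.map_comp]
    rfl
  exact congrArg (fun k : (X.realizationDiagram R).obj Y ⟶ (X.realizationDiagram R).obj W => k r) h2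

instance : (X.realizationDiagram R ⋙ Scheme.forget).IsLocallyDirected where
  cond f g p q h := exists_common_preimage f g p q h

/-- The base extension `X_R` of a monoid scheme `X` to a ring `R`: the colimit of the affine
schemes `U_R = Spec ((Γ U)_R)`, for `U` affine open in `X`. -/
def realization : Scheme.{u} := colimit (X.realizationDiagram R)

/-- The open immersion `U_R → X_R`. -/
def realizationι (U : X.Affines) :
    Spec (CommRingCat.of (BaseExt R U.sec)) ⟶ X.realization R :=
  colimit.ι (X.realizationDiagram R) U

instance (U : X.Affines) : IsOpenImmersion (X.realizationι R U) :=
  inferInstanceAs (IsOpenImmersion (colimit.ι (X.realizationDiagram R) U))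

variable {X R} in
/-- Continuous maps `U_R → T` which are compatible with inclusions glue to a map `X_R → T`. -/
theorem exists_desc {T : Type u} [TopologicalSpace T]
    (f : ∀ U : X.Affines, C(PrimeSpectrum (BaseExt R U.sec), T))
    (hf : ∀ {U V : X.Affines} (g : U ⟶ V) (p : PrimeSpectrum (BaseExt R U.sec)), f V ((X.realizationDiagram R).map g p) = f U p) :
    ∃ F : C(X.realization R, T), ∀ (U : X.Affines) (p : PrimeSpectrum (BaseExt R U.sec)),
      F (X.realizationι R U p) = f U p := by
  have hs : ∀ x : X.realization R, ∃ U : X.Affines, ∃ p : PrimeSpectrum (BaseExt R U.sec),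
      X.realizationι R U p = x := fun x => Scheme.IsLocallyDirected.ι_jointly_surjective _ x
  choose U p hp using hs
  have key : ∀ V q, f (U (X.realizationι R V q)) (p (X.realizationι R V q)) = f V q := by
    intro V q
    obtain ⟨k, fi, fj, z, h1, h2⟩ := (Scheme.IsLocallyDirected.ι_eq_ι_iff
      (X.realizationDiagram R)).1 (hp (X.realizationι R V q))
    exact (congrArg (f _) h1).symm.trans (((hf fi z).trans (hf fj z).symm).trans
      (congrArg (f V) h2))
  have hc : ∀ (V : X.Affines) (q : PrimeSpectrum (BaseExt R V.sec)),
      ContinuousAt (fun x => f (U x) (p x)) (X.realizationι R V q) := by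
    intro V q
    refine ((X.realizationι R V).isOpenEmbedding.continuousAt_iff (x := q)).1 ?_
    have h : (fun x => f (U x) (p x)) ∘ (X.realizationι R V) = f V := funext fun q => key V q
    rw [h]
    exact (f V).continuous.continuousAt
  refine ⟨⟨fun x => f (U x) (p x), continuous_iff_continuousAt.2 fun x => ?_⟩, key⟩
  have h := hc (U x) (p x)
  rwa [hp] at h

/-- The underlying continuous map of `p_R : X_R^• → X`, given on `U_R` by `𝔭 ↦ 𝔭 ∩ Γ U`. -/
def realizationProj : C(X.realization R, X) :=
  (exists_desc (X.specPoint R) fun g p => specPoint_map g p).choose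

theorem realizationProj_ι (U : X.Affines) (p : PrimeSpectrum (BaseExt R U.sec)) :
    X.realizationProj R (X.realizationι R U p) = X.specPoint R U p :=
  (exists_desc (X.specPoint R) fun g p => specPoint_map g p).choose_spec U p

/-- The open subset `U_R` of `X_R`. -/
def realizationOpen (U : X.Affines) : (X.realization R).Opens := X.realizationι R U ''ᵁ ⊤

theorem exists_desc_gamma : ∃ F : C(X.realization R, X.SCongSpace),
    ∀ (U : X.Affines) (p : PrimeSpectrum (BaseExt R U.sec)),
      F (X.realizationι R U p) = X.scongι U (specToSCong (BaseExt.of R) p) := by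
  refine exists_desc (fun U => (X.scongι U).comp (specToSCong (BaseExt.of R))) ?_
  intro U V g p
  have h : SCong.comap (AffineOpens.res g.le) (specToSCong (BaseExt.of R) p) =
      specToSCong (BaseExt.of R) ((X.realizationDiagram R).map g p) := by
    refine Subtype.ext (Con.ext fun a b => ?_)
    refine (Ideal.Quotient.eq (I := p.asIdeal)).trans (Iff.trans ?_ (Ideal.Quotient.eq
      (I := ((X.realizationDiagram R).map g p : PrimeSpectrum _).asIdeal)).symm)
    change _ ↔ BaseExt.map _ (BaseExt.of R a - BaseExt.of R b) ∈ p.asIdeal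
    rw [map_sub, BaseExt.map_of, BaseExt.map_of]
  change X.scongι V (specToSCong (BaseExt.of R) ((X.realizationDiagram R).map g p)) = _
  rw [← h]
  exact congrArg (fun f => f.hom (specToSCong (BaseExt.of R) p)) (colimit.w X.scongDiagram g)

/-- The continuous map `γ : X_R → SCong X`, which is given on `U_R`, for `U` affine open in `X`, by
the map `U_R → SCong (Γ U)` induced by `Γ U → (Γ U)_R^•`. -/
def gamma : C(X.realization R, X.SCongSpace) := (X.exists_desc_gamma R).choose

theorem gamma_ι (U : X.Affines) (p : PrimeSpectrum (BaseExt R U.sec)) :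
    X.gamma R (X.realizationι R U p) = X.scongι U (specToSCong (BaseExt.of R) p) :=
  (X.exists_desc_gamma R).choose_spec U p

theorem exists_realizationι (x : X.realization R) :
    ∃ U : X.Affines, ∃ p : PrimeSpectrum (BaseExt R U.sec),
    X.realizationι R U p = x :=
  Scheme.IsLocallyDirected.ι_jointly_surjective _ x

/-- The underlying map of `p_R : X_R^• → X` factorizes through `γ`. -/
theorem congProj_gamma (x : X.realization R) :
    X.congProj (X.scongIncl (X.gamma R x)) = X.realizationProj R x := by
  obtain ⟨U, p, rfl⟩ := X.exists_realizationι R x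
  rw [gamma_ι, scongIncl_scongι, congProj_congι, realizationProj_ι, nullIdeal_specToSCong]
  rfl

/-- `p_R⁻¹(U) = U_R` for `U` affine open in `X`. -/
theorem mem_realizationOpen_iff (U : X.Affines) (x : X.realization R) :
    x ∈ X.realizationOpen R U ↔ X.realizationProj R x ∈ U.1 := by
  refine ⟨?_, fun hx => ?_⟩
  · rintro ⟨p, _, rfl⟩
    exact (X.realizationProj_ι R U p).symm ▸ X.specPoint_mem R U p
  · obtain ⟨V, q, rfl⟩ := X.exists_realizationι R x
    rw [realizationProj_ι] at hx
    obtain ⟨Y, hYV, hYU, hY⟩ := AffineOpens.exists_le V (X.specPoint_mem R V q) hx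
    obtain ⟨r, rfl⟩ := exists_preimage (homOfLE hYV) q hY
    refine ⟨(X.realizationDiagram R).map (homOfLE (show Y ≤ U from hYU)) r, trivial, ?_⟩
    refine (congrArg (fun f : _ ⟶ X.realization R => f r)
      (colimit.w (X.realizationDiagram R) (homOfLE (show Y ≤ U from hYU)))).trans ?_
    exact (congrArg (fun f : _ ⟶ X.realization R => f r)
      (colimit.w (X.realizationDiagram R) (homOfLE hYV))).symm

/-- The morphism `p_R^#(U) : Γ U → Γ(U_R, O_{X_R})^•`, for `U` affine open in `X`: the
morphism `Γ U → (Γ U)_R^•`, where `(Γ U)_R` is the ring of functions of `U_R = Spec ((Γ U)_R)`. -/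
def realizationSharp (U : X.Affines) : U.sec →*₀ Γ(X.realization R, X.realizationOpen R U) :=
  ((Scheme.ΓSpecIso (CommRingCat.of (BaseExt R U.sec))).inv ≫
    ((X.realizationι R U).appIso ⊤).inv).hom.toMonoidWithZeroHom.comp (BaseExt.of R)

theorem congProj_gamma_mem {U : X.Affines} {x : X.realization R} (hx : x ∈ X.realizationOpen R U) :
    X.congProj (X.scongIncl (X.gamma R x)) ∈ U.1 := by
  rw [congProj_gamma]
  exact (X.mem_realizationOpen_iff R U x).1 hx

/-- The residue pointed group `κ(γ(x)) = O_{X, p_R(x)} / 𝔠_{γ(x)}` for `x ∈ X_R`. -/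
abbrev GammaResidue (x : X.realization R) : Type u := X.CongResidue (X.scongIncl (X.gamma R x))

/-- For `U` affine open in `X` and `x ∈ U_R`, the morphism `Γ U → O_{X, p_R(x)} → κ(γ(x))`. -/
def toGammaResidue (U : X.Affines) (x : X.realization R) (hx : x ∈ X.realizationOpen R U) :
    U.sec →*₀ X.GammaResidue R x :=
  (X.congResidueMk _).comp (X.germ U.1 _ (X.congProj_gamma_mem R hx))

/-- For `U` affine open in `X` and `x ∈ U_R`, the morphism `Γ U → Γ(U_R, O_{X_R})^• → κ(x)^•`
obtained from `p_R^#(U)` by evaluating functions at `x`. -/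
def toResidueField (U : X.Affines) (x : X.realization R) (hx : x ∈ X.realizationOpen R U) :
    U.sec →*₀ (X.realization R).residueField x :=
  ((X.realization R).evaluation (X.realizationOpen R U) x hx).hom.toMonoidWithZeroHom.comp
    (X.realizationSharp R U)

end MonoidScheme
end F1

end

/-! Everything follows from one identity: the congruence 𝔠 at γ(x) is the congruence kernel of the
morphism from the stalk O at p_R(x) to κ(x)^• which takes a germ on an affine U to its value at x
(`stalkCon_gamma`). The quotient by a congruence kernel embeds, which gives γ_x and its injectivity.

For the identity, let U be an affine neighbourhood of p_R(x) and let 𝔭 be the point of U_R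
corresponding to x. Evaluation at x has kernel 𝔭, so two sections over U have the same value at x
exactly when they are congruent for the prime congruence defined by 𝔭, which represents γ(x). Any
two germs with the same value live on a common such U, so they form one of the generators of 𝔠.
Conversely, a generator comes from some prime congruence on Γ U with image γ(x), and it lies in the
kernel provided that this congruence is the one defined by 𝔭. This is where the injectivity of Cong
Γ U → X^cong enters (`congι_injective`).

Injectivity is not formal, since a colimit may identify points of one of its pieces. It is proved by
an invariant: a prime congruence on Γ U extends to a relation on the stalk at the point given by its
null ideal. This relation is unchanged when U is enlarged, because inclusions of affine opens are
localizations. It determines the congruence, because sections invertible at that point lie outside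
the null ideal and can be cancelled.

Finally, p_R(x) is the point given by the null ideal of the congruence of γ(x). A non-invertible
germ therefore has value 0 at x, so every nonzero class in the quotient lifts to a unit
(`isUnit_of_stalkHom_ne_zero`). Uniqueness holds because germs on affine opens exhaust the stalk. -/

noncomputable section

open CategoryTheory CategoryTheory.Limits AlgebraicGeometry TopologicalSpace

namespace F1

open MonoidalSpace

/-! ### Sections and germs on affine open subsets. -/

namespace MonoidalSpace

variable {X : MonoidalSpace.{u}}

/-- Two sections of an affine open subset with the same germ at a point become equal after
multiplication with a section which is invertible at that point. -/
theorem AffineOpens.exists_mul_eq_of_germ_eq {U : AffineOpens X} {y : X} (hy : y ∈ U.1)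
    {a b : U.sec} (h : X.germ U.1 y hy a = X.germ U.1 y hy b) :
    ∃ k : U.sec, IsUnit (X.germ U.1 y hy k) ∧ k * a = k * b := by
  have hU : ∀ s, U.chart.toSec s = s := fun s => by rw [chart_toSec]; rfl
  obtain ⟨W, hW, _, hyW, hres⟩ := exists_res_eq_of_germ_eq h
  obtain ⟨g, hyg, hgW⟩ := U.chart.exists_basic hyW hy
  have hloc := U.chart.basic_loc g
  simp only [hU] at hloc
  obtain ⟨⟨_, n, rfl⟩, hk⟩ := hloc.exists_of_eq (x := a) (y := b) (by
    rw [← X.res_res hgW hW, ← X.res_res hgW hW, hres])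
  refine ⟨g ^ n, ?_, hk⟩
  rw [map_pow, ← germ_res (U.chart.basic_le g) y hyg]
  exact ((hloc.map_units ⟨g, Submonoid.mem_powers g⟩).map _).pow n

/-- Sections over an affine open subset `U` of `V` are, up to powers of a unit, restrictions of
sections over `V`. -/
theorem AffineOpens.exists_lift {U V : AffineOpens X} (h : U ≤ V) :
    ∃ g : V.sec, IsUnit (res h g) ∧ ∀ s : U.sec, ∃ (n : ℕ) (t : V.sec),
      s * res h g ^ n = res h t := by
  obtain ⟨g, hg⟩ := AffineOpens.exists_loc h
  refine ⟨g, hg.map_units ⟨g, Submonoid.mem_powers g⟩, fun s => ?_⟩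
  obtain ⟨⟨t, ⟨_, n, rfl⟩⟩, ht⟩ := hg.surj s
  exact ⟨n, t, by simpa only [map_pow] using ht⟩

end MonoidalSpace

/-! ### Injectivity of Cong Γ U → X^cong. -/

namespace MonoidScheme

variable {X : MonoidScheme.{u}}

/-- The relation on the stalk at `y` which is induced by a prime congruence `c` on `Γ U`; it is
empty unless `y` is the point of `U` given by the null ideal of `c`. -/
def stalkRel (U : X.Affines) (c : Cong U.sec) (y : X) (s t : X.Stalk y) : Prop :=
  ∃ hy : y ∈ U.1, AffineOpens.point U (Cong.nullIdeal U.sec c) = y ∧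
    ∃ a b k : U.sec, IsUnit (X.germ U.1 y hy k) ∧ c.1 a b ∧
      s * X.germ U.1 y hy k = X.germ U.1 y hy a ∧ t * X.germ U.1 y hy k = X.germ U.1 y hy b

theorem point_nullIdeal_comap {U V : X.Affines} (h : U ≤ V) (c : Cong U.sec) :
    AffineOpens.point V (Cong.nullIdeal _ (Cong.comap (AffineOpens.res h) c)) =
      AffineOpens.point U (Cong.nullIdeal _ c) := by
  refine Eq.trans ?_ (AffineOpens.point_comap h (Cong.nullIdeal _ c))
  refine congrArg (AffineOpens.point V) (MSpec.ext (Set.ext fun a => ?_))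
  change c.1 (X.res _ a) (X.res _ 0) ↔ c.1 (X.res _ a) 0
  rw [map_zero]

/-- Sections over U are fractions of sections over V with denominators invertible on U. The unit
factor `k` in `stalkRel` absorbs these denominators, so the relation does not see which affine open
it was computed on. -/
theorem stalkRel_comap {U V : X.Affines} (h : U ≤ V) (c : Cong U.sec) :
    stalkRel V (Cong.comap (AffineOpens.res h) c) = stalkRel U c := by
  funext y s t
  refine propext ⟨?_, ?_⟩
  · rintro ⟨hyV, hp, a, b, k, hk, hc, hs, ht⟩
    rw [point_nullIdeal_comap] at hp
    -- The condition on the null ideal forces `y` into the smaller open U; at points of V outside U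
    -- both relations are empty.
    have hy : y ∈ U.1 := hp ▸ AffineOpens.point_mem U _
    refine ⟨hy, hp, AffineOpens.res h a, AffineOpens.res h b, AffineOpens.res h k, ?_, hc, ?_, ?_⟩
    · rwa [germ_res h y hy]
    · rwa [germ_res h y hy, germ_res h y hy]
    · rwa [germ_res h y hy, germ_res h y hy]
  · rintro ⟨hy, hp, a, b, k, hk, hc, hs, ht⟩
    obtain ⟨g, hg, hlift⟩ := AffineOpens.exists_lift h
    obtain ⟨n, a', ha⟩ := hlift a
    obtain ⟨m, b', hb⟩ := hlift b
    obtain ⟨l, k', hk'⟩ := hlift k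
    have hgy : IsUnit (X.germ V.1 y (h hy) g) := by
      rw [← germ_res h y hy]
      exact hg.map _
    have ha' := congrArg (X.germ U.1 y hy) ha
    have hb' := congrArg (X.germ U.1 y hy) hb
    have hkk := congrArg (X.germ U.1 y hy) hk'
    simp only [map_mul, map_pow, AffineOpens.res, germ_res h y hy] at ha' hb' hkk
    -- On U, the sections `a`, `b`, `k` are `a' / g ^ n`, `b' / g ^ m`, `k' / g ^ l`. Multiplying
    -- all three by the common denominator `g ^ (n + m + l)` gives sections defined over V.
    refine ⟨h hy, (point_nullIdeal_comap h c).trans hp, a' * g ^ (m + l), b' * g ^ (n + l),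
      k' * g ^ (n + m), ?_, ?_, ?_, ?_⟩
    · rw [map_mul, map_pow, ← hkk]
      exact (hk.mul (hgy.pow _)).mul (hgy.pow _)
    · change c.1 (AffineOpens.res h (a' * g ^ (m + l))) (AffineOpens.res h (b' * g ^ (n + l)))
      simp only [map_mul, map_pow, ← ha, ← hb]
      have e1 : a * AffineOpens.res h g ^ n * AffineOpens.res h g ^ (m + l) =
          a * AffineOpens.res h g ^ (n + m + l) := by rw [mul_assoc, ← pow_add, add_assoc]
      have e2 : b * AffineOpens.res h g ^ m * AffineOpens.res h g ^ (n + l) =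
          b * AffineOpens.res h g ^ (n + m + l) := by
        rw [mul_assoc, ← pow_add, ← add_assoc, add_comm m n]
      rw [e1, e2]
      exact c.1.mul hc (c.1.refl _)
    · simp only [map_mul, map_pow, ← ha', ← hkk, ← hs, pow_add]
      ac_rfl
    · simp only [map_mul, map_pow, ← hb', ← hkk, ← ht, pow_add]
      ac_rfl

/-- The relations on the stalks of `X`, with the indiscrete topology. -/
def StalkRels (X : MonoidScheme.{u}) : Type u := ∀ y : X, X.Stalk y → X.Stalk y → ULift.{u} Prop

/-- Every map into an indiscrete space is continuous, so a compatible family of maps of sets already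
descends to the colimit in `TopCat`. This suffices to separate points. -/
instance : TopologicalSpace (StalkRels X) := ⊤

/-- The map `stalkRel U`, as a continuous map to an indiscrete space. -/
def stalkRels (U : X.Affines) : C(Cong U.sec, StalkRels X) :=
  ⟨fun c y s t => ULift.up (stalkRel U c y s t), continuous_top⟩

/-- The maps `stalkRel U` as a cocone. -/
def stalkRelCocone : Cocone X.congDiagram where
  pt := TopCat.of (StalkRels X)
  ι :=
    { app := fun U => TopCat.ofHom (stalkRels U)
      naturality := fun {_ V} f => by
        ext c
        exact congrArg (fun (r : ∀ y : X, X.Stalk y → X.Stalk y → Prop) y s t =>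
          ULift.up (r y s t)) (stalkRel_comap f.le c) }

/-- The cocone `stalkRelCocone` factors through the colimit, so the relation depends only on the
point of X^cong. -/
theorem stalkRel_eq_of_congι_eq {U V : X.Affines} {c : Cong U.sec} {d : Cong V.sec}
    (h : X.congι U c = X.congι V d) : stalkRel U c = stalkRel V d := by
  have key : ∀ (W : X.Affines) (e : Cong W.sec),
      (colimit.desc X.congDiagram stalkRelCocone).hom (X.congι W e) = stalkRels W e := fun W e =>
    congrArg (fun f : X.congDiagram.obj W ⟶ TopCat.of (StalkRels X) => f.hom e)
      (colimit.ι_desc stalkRelCocone W)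
  have h' := (key U c).symm.trans ((congrArg _ h).trans (key V d))
  funext y s t
  exact congrArg ULift.down (congrFun (congrFun (congrFun h' y) s) t)

/-- A pair in `c` is related in the stalk, hence related through `d` up to factors that are
invertible at the common point. Such factors are nonzero modulo `d`, and integrality of the quotient
by `d` removes them. -/
theorem le_of_stalkRel_eq {U : X.Affines} {c d : Cong U.sec} (h : stalkRel U c = stalkRel U d) :
    c.1 ≤ d.1 := by
  intro a b hab
  have hy := AffineOpens.point_mem U (Cong.nullIdeal U.sec c)
  have hc : stalkRel U c _ (X.germ U.1 _ hy a) (X.germ U.1 _ hy b) :=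
    ⟨hy, rfl, a, b, 1, by rw [map_one]; exact isUnit_one, hab, by simp, by simp⟩
  rw [h] at hc
  obtain ⟨_, hp, a', b', k, hk, hd, ha, hb⟩ := hc
  rw [← map_mul] at ha hb
  -- The equalities with the witnesses `a'`, `b'` for `d` hold only for germs; the multipliers `v`
  -- and `w` turn them into equalities of sections over U.
  obtain ⟨v, hv, hva⟩ := AffineOpens.exists_mul_eq_of_germ_eq hy ha
  obtain ⟨w, hw, hwb⟩ := AffineOpens.exists_mul_eq_of_germ_eq hy hb
  -- By `hp` the null ideals of `c` and `d` give the same point, so a section with invertible germ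
  -- there is outside the null ideal of `d`.
  have hu : ¬ d.1 (v * w * k) 0 := by
    intro h0
    have h1 : v * w * k ∈ (Cong.nullIdeal U.sec d).carrier := h0
    rw [(AffineOpens.eq_point_iff U _ _ hy).1 hp, map_mul, map_mul] at h1
    exact h1 ((hv.mul hw).mul hk)
  have hmul : d.1 (v * w * k * a) (v * w * k * b) := by
    have e1 : v * w * k * a = w * v * a' := by rw [mul_assoc w, ← hva]; ac_rfl
    have e2 : v * w * k * b = w * v * b' := by
      rw [mul_comm w v, mul_assoc v w b', ← hwb]; ac_rfl
    rw [e1, e2]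
    exact d.1.mul (d.1.refl _) hd
  refine (d.2.2 (conMk d.1 (v * w * k)) (conMk d.1 a) (conMk d.1 b) ?_).elim
    (fun h0 => (hu (conMk_eq.1 (h0.trans (map_zero _).symm))).elim) conMk_eq.1
  rw [← map_mul, ← map_mul]
  exact conMk_eq.2 hmul

variable (X) in
/-- The maps `Cong (Γ U) → X^cong` are injective. -/
theorem congι_injective (U : X.Affines) : Function.Injective (X.congι U) := fun _ _ h =>
  Subtype.ext (le_antisymm (le_of_stalkRel_eq (stalkRel_eq_of_congι_eq h))
    (le_of_stalkRel_eq (stalkRel_eq_of_congι_eq h).symm))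

end MonoidScheme
end F1

/-! ### Evaluation of functions on affine opens of X_R. -/

namespace F1
namespace MonoidScheme

open MonoidalSpace

section

variable {A B : CommRingCat.{u}} {Y : Scheme.{u}}

/-- A function vanishes at a point exactly outside its basic open set. An open immersion carries
basic opens to basic opens, which reduces the claim to the basic open of `s` in `Spec A`. -/
theorem evaluation_appIso_inv_eq_zero_iff (f : Spec A ⟶ Y) [IsOpenImmersion f] (p : Spec A)
    (hx : f p ∈ f ''ᵁ ⊤) (s : A) :
    Y.evaluation (f ''ᵁ ⊤) (f p) hx ((f.appIso ⊤).inv ((Scheme.ΓSpecIso A).inv s)) = 0 ↔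
      s ∈ p.asIdeal := by
  rw [Scheme.evaluation_eq_zero_iff_notMem_basicOpen, ← Scheme.image_basicOpen,
    basicOpen_eq_of_affine, not_iff_comm]
  refine ⟨fun hp => ⟨p, hp, rfl⟩, ?_⟩
  rintro ⟨q, hq, h⟩
  rwa [← f.isOpenEmbedding.injective h]

/-- This compares functions on two nested affine charts of the same scheme. Once `g.appIso` is moved
to the other side, it is naturality of `ΓSpecIso` together with the behaviour of `appLE` under
composition. -/
theorem map_ΓSpecIso_inv_appIso_inv (φ : A ⟶ B) (f : Spec A ⟶ Y) (g : Spec B ⟶ Y)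
    [IsOpenImmersion f] [IsOpenImmersion g] (hw : Spec.map φ ≫ f = g)
    (hle : g ''ᵁ ⊤ ≤ f ''ᵁ ⊤) :
    φ ≫ (Scheme.ΓSpecIso B).inv ≫ (g.appIso ⊤).inv =
      (Scheme.ΓSpecIso A).inv ≫ (f.appIso ⊤).inv ≫ Y.presheaf.map (homOfLE hle).op := by
  subst hw
  rw [← Category.assoc, Iso.comp_inv_eq, Category.assoc, Category.assoc,
    Scheme.Hom.appIso_hom', Scheme.ΓSpecIso_inv_naturality, Scheme.Hom.map_appLE,
    ← Scheme.Hom.appLE_comp_appLE (Spec.map φ) f (f ''ᵁ ⊤) ⊤ ⊤ (f.preimage_image_eq ⊤).ge le_rfl,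
    ← Category.assoc (f.appIso ⊤).inv, Scheme.Hom.appIso_inv_appLE]
  exact congrArg _ ((Scheme.Hom.appLE_eq_app _).symm.trans
    (Scheme.Hom.map_appLE (Spec.map φ) (V := ⊤) (U := ⊤) (U' := ⊤) le_rfl (𝟙 _)).symm)

end

variable {X : MonoidScheme.{u}} {R : Type u} [CommRing R]

/-- The ring homomorphism `(Γ U)_R → Γ(U_R, O_{X_R}) → κ(x)`, for `x ∈ U_R`. -/
def evalHom (U : X.Affines) (x : X.realization R) (hx : x ∈ X.realizationOpen R U) :
    BaseExt R U.sec →+* (X.realization R).residueField x :=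
  ((Scheme.ΓSpecIso (CommRingCat.of (BaseExt R U.sec))).inv ≫
    ((X.realizationι R U).appIso ⊤).inv ≫
      (X.realization R).evaluation (X.realizationOpen R U) x hx).hom

theorem toResidueField_apply (U : X.Affines) (x : X.realization R)
    (hx : x ∈ X.realizationOpen R U) (a : U.sec) :
    X.toResidueField R U x hx a = evalHom U x hx (BaseExt.of R a) := rfl

theorem evalHom_eq_zero_iff (U : X.Affines) (p : PrimeSpectrum (BaseExt R U.sec))
    (hx : X.realizationι R U p ∈ X.realizationOpen R U) (s : BaseExt R U.sec) :
    evalHom U _ hx s = 0 ↔ s ∈ p.asIdeal :=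
  evaluation_appIso_inv_eq_zero_iff (X.realizationι R U) p hx s

theorem realizationOpen_mono {U V : X.Affines} (h : U ≤ V) :
    X.realizationOpen R U ≤ X.realizationOpen R V := fun x hx =>
  (X.mem_realizationOpen_iff R V x).2 (h ((X.mem_realizationOpen_iff R U x).1 hx))

theorem evalHom_map {U V : X.Affines} (h : U ≤ V) (x : X.realization R)
    (hx : x ∈ X.realizationOpen R U) (s : BaseExt R V.sec) :
    evalHom U x hx (BaseExt.map (AffineOpens.res h) s) =
      evalHom V x (realizationOpen_mono h hx) s := by
  have e := map_ΓSpecIso_inv_appIso_inv (CommRingCat.ofHom (BaseExt.map (R := R)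
    (AffineOpens.res h))) (X.realizationι R V) (X.realizationι R U)
    (colimit.w (X.realizationDiagram R) (homOfLE h)) (realizationOpen_mono h)
  have e1 := congrArg (fun f => (X.realization R).evaluation (X.realizationOpen R U) x hx (f s)) e
  refine e1.trans ?_
  -- Evaluation at `x` factors through the germ at `x`, which restriction to a smaller neighbourhood
  -- does not change.
  exact congrArg (fun y => (X.realization R).residue x y)
    ((X.realization R).presheaf.germ_res_apply (homOfLE (realizationOpen_mono h)) x hx _)

end MonoidScheme
end F1

/-! ### The morphism from the stalk to κ(x)^• and its congruence kernel. -/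

namespace F1
namespace MonoidScheme

open MonoidalSpace

variable {X : MonoidScheme.{u}} {R : Type u} [CommRing R]

theorem toResidueField_res {U V : X.Affines} (h : U ≤ V) (x : X.realization R)
    (hx : x ∈ X.realizationOpen R U) (a : V.sec) :
    X.toResidueField R U x hx (AffineOpens.res h a) =
      X.toResidueField R V x (realizationOpen_mono h hx) a := by
  rw [toResidueField_apply, toResidueField_apply, ← evalHom_map h, BaseExt.map_of]

/-- Evaluation at the point `p` has kernel `p`, so two sections have equal values exactly when their
difference in the base extension lies in `p`. -/
theorem toResidueField_eq_iff (U : X.Affines) (p : PrimeSpectrum (BaseExt R U.sec))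
    (hx : X.realizationι R U p ∈ X.realizationOpen R U) (a b : U.sec) :
    X.toResidueField R U _ hx a = X.toResidueField R U _ hx b ↔
      (specToSCong (BaseExt.of R) p).1 a b := by
  rw [toResidueField_apply, toResidueField_apply, ← sub_eq_zero, ← map_sub, evalHom_eq_zero_iff]
  exact (Ideal.Quotient.eq (I := p.asIdeal)).symm

variable (x : X.realization R)

/-- The point `π_X(γ(x)) = p_R(x)` of `X`. -/
abbrev basePoint : X := X.congProj (X.scongIncl (X.gamma R x))

variable {x}

theorem mem_realizationOpen_of_basePoint_mem {U : X.Affines} (h : basePoint x ∈ U.1) :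
    x ∈ X.realizationOpen R U := by
  rw [basePoint, congProj_gamma] at h
  exact (X.mem_realizationOpen_iff R U x).2 h

theorem exists_realizationι_eq {U : X.Affines} (h : basePoint x ∈ U.1) :
    ∃ p : PrimeSpectrum (BaseExt R U.sec), X.realizationι R U p = x := by
  obtain ⟨p, _, hp⟩ := mem_realizationOpen_of_basePoint_mem h
  exact ⟨p, hp⟩

theorem exists_le_of_basePoint_mem {W : Opens X} (hx : basePoint x ∈ W) :
    ∃ U : X.Affines, U.1 ≤ W ∧ basePoint x ∈ U.1 := by
  obtain ⟨V, hV⟩ := X.exists_affine (basePoint x)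
  obtain ⟨U, _, hU, hxU⟩ := AffineOpens.exists_le V hV hx
  exact ⟨U, hU, hxU⟩

/-- Equal germs agree on some neighbourhood, which can be shrunk to an affine one; the value at `x`
can be computed there. This is the well-definedness of evaluation on the stalk. -/
theorem toResidueField_eq_of_germ_eq {U V : X.Affines} (hU : basePoint x ∈ U.1)
    (hV : basePoint x ∈ V.1) {a : U.sec} {b : V.sec}
    (h : X.germ U.1 (basePoint x) hU a = X.germ V.1 (basePoint x) hV b) :
    X.toResidueField R U x (mem_realizationOpen_of_basePoint_mem hU) a =
      X.toResidueField R V x (mem_realizationOpen_of_basePoint_mem hV) b := by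
  obtain ⟨W, hWU, hWV, hxW, hW⟩ := exists_res_eq_of_germ_eq h
  obtain ⟨Y, hYW, hY⟩ := exists_le_of_basePoint_mem hxW
  have hYU : Y ≤ U := hYW.trans hWU
  have hYV : Y ≤ V := hYW.trans hWV
  rw [← toResidueField_res hYU x (mem_realizationOpen_of_basePoint_mem hY),
    ← toResidueField_res hYV x (mem_realizationOpen_of_basePoint_mem hY)]
  refine congrArg _ ?_
  have h' := congrArg (X.res hYW) hW
  rwa [res_res, res_res] at h'

theorem exists_affine_germ₂ (s t : X.Stalk (basePoint x)) :
    ∃ (U : X.Affines) (hU : basePoint x ∈ U.1) (a b : U.sec),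
      X.germ U.1 _ hU a = s ∧ X.germ U.1 _ hU b = t := by
  obtain ⟨V, hV, a, rfl⟩ := exists_germ _ s
  obtain ⟨W, hW, b, rfl⟩ := exists_germ _ t
  obtain ⟨U, hUVW, hU⟩ := exists_le_of_basePoint_mem (W := V ⊓ W) ⟨hV, hW⟩
  exact ⟨U, hU, X.res (hUVW.trans inf_le_left) a, X.res (hUVW.trans inf_le_right) b,
    germ_res _ _ hU a, germ_res _ _ hU b⟩

theorem exists_affine_germ (s : X.Stalk (basePoint x)) :
    ∃ (U : X.Affines) (hU : basePoint x ∈ U.1) (a : U.sec), X.germ U.1 _ hU a = s := by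
  obtain ⟨U, hU, a, _, ha, _⟩ := exists_affine_germ₂ s s
  exact ⟨U, hU, a, ha⟩

/-- The stalk is a limit over all open neighbourhoods, while values at `x` are available only for
sections over affine ones. The map is defined through a chosen affine representative of each germ.
-/
theorem exists_stalkHom : ∃ ψ : X.Stalk (basePoint x) →*₀ (X.realization R).residueField x,
    ∀ (U : X.Affines) (hU : basePoint x ∈ U.1) (a : U.sec), ψ (X.germ U.1 _ hU a) =
      X.toResidueField R U x (mem_realizationOpen_of_basePoint_mem hU) a := by
  choose U hU a ha using exists_affine_germ (x := x)
  let ψ : X.Stalk (basePoint x) → (X.realization R).residueField x := fun s =>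
    X.toResidueField R (U s) x (mem_realizationOpen_of_basePoint_mem (hU s)) (a s)
  have key : ∀ (V : X.Affines) (hV : basePoint x ∈ V.1) (b : V.sec), ψ (X.germ V.1 _ hV b) =
      X.toResidueField R V x (mem_realizationOpen_of_basePoint_mem hV) b := fun V hV b =>
    toResidueField_eq_of_germ_eq _ _ (ha _)
  refine ⟨⟨⟨ψ, ?_⟩, ?_, fun s t => ?_⟩, key⟩
  · change ψ 0 = 0
    rw [← map_zero (X.germ (U 0).1 _ (hU 0)), key, map_zero]
  · change ψ 1 = 1
    rw [← map_one (X.germ (U 0).1 _ (hU 0)), key, map_one]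
  -- The representatives chosen for `s`, `t` and `s * t` may live on different opens. A common
  -- affine open replaces them, and `key` shows that this does not affect the values.
  · obtain ⟨V, hV, b, c, rfl, rfl⟩ := exists_affine_germ₂ s t
    change ψ _ = ψ _ * ψ _
    rw [← map_mul, key, key, key, map_mul]

variable (x) in
/-- The morphism `O_{X, p_R(x)} → κ(x)^•` induced by `p_R`. -/
def stalkHom : X.Stalk (basePoint x) →*₀ (X.realization R).residueField x :=
  exists_stalkHom.choose

theorem stalkHom_germ (U : X.Affines) (hU : basePoint x ∈ U.1) (a : U.sec) :
    stalkHom x (X.germ U.1 _ hU a) =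
      X.toResidueField R U x (mem_realizationOpen_of_basePoint_mem hU) a :=
  exists_stalkHom.choose_spec U hU a

/-- The prime congruences on `Γ U` which correspond to `γ(x)` are the congruence kernel of
`Γ U → κ(x)^•`. -/
theorem congι_eq_gamma_iff (U : X.Affines) (hU : basePoint x ∈ U.1) (c : Cong U.sec) :
    X.congι U c = X.scongIncl (X.gamma R x) ↔ c.1 = congker
      (X.toResidueField R U x (mem_realizationOpen_of_basePoint_mem hU)) := by
  obtain ⟨p, rfl⟩ := exists_realizationι_eq hU
  -- Injectivity excludes any further prime congruence on Γ U with image γ(x).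
  rw [gamma_ι, scongIncl_scongι, (X.congι_injective U).eq_iff]
  have h : (specToSCong (BaseExt.of R) p).toCong.1 = congker (X.toResidueField R U
      (X.realizationι R U p) (mem_realizationOpen_of_basePoint_mem hU)) :=
    Con.ext fun a b => (toResidueField_eq_iff U p _ a b).symm
  rw [← h]
  exact Subtype.ext_iff

/-- Every affine neighbourhood of the base point thus contributes generators to `stalkCon`. -/
theorem exists_congι_eq_gamma (U : X.Affines) (hU : basePoint x ∈ U.1) :
    ∃ c : Cong U.sec, X.congι U c = X.scongIncl (X.gamma R x) := by
  obtain ⟨p, rfl⟩ := exists_realizationι_eq hU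
  exact ⟨(specToSCong (BaseExt.of R) p).toCong, by rw [gamma_ι, scongIncl_scongι]⟩

/-- The congruence `𝔠_{γ(x)}` is the congruence kernel of `O_{X, p_R(x)} → κ(x)^•`. -/
theorem stalkCon_gamma : X.stalkCon (X.scongIncl (X.gamma R x)) = congker (stalkHom x) := by
  refine le_antisymm (Con.conGen_le.2 ?_) fun s t h => ?_
  · rintro _ _ ⟨U, hU, c, hc, a, b, hab, rfl, rfl⟩
    rw [(congι_eq_gamma_iff U hU c).1 hc] at hab
    change stalkHom x _ = stalkHom x _
    rw [stalkHom_germ, stalkHom_germ]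
    exact hab
  · obtain ⟨U, hU, a, b, rfl, rfl⟩ := exists_affine_germ₂ s t
    obtain ⟨c, hc⟩ := exists_congι_eq_gamma U hU
    -- A pair in the kernel is itself a generator; the closure operations of the generated
    -- congruence are not needed.
    refine ConGen.Rel.of _ _ ⟨U, hU, c, hc, a, b, ?_, rfl, rfl⟩
    rw [(congι_eq_gamma_iff U hU c).1 hc]
    change stalkHom x _ = stalkHom x _ at h
    rwa [stalkHom_germ, stalkHom_germ] at h

/-- A germ which does not vanish at `x` is invertible. -/
theorem isUnit_of_stalkHom_ne_zero {s : X.Stalk (basePoint x)} (hs : stalkHom x s ≠ 0) :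
    IsUnit s := by
  obtain ⟨U, hU, a, rfl⟩ := exists_affine_germ s
  obtain ⟨c, hc⟩ := exists_congι_eq_gamma U hU
  have hy : AffineOpens.point U (Cong.nullIdeal U.sec c) = basePoint x := by
    rw [← congProj_congι, hc]
  by_contra h
  -- The base point is given by the null ideal of `c`, which therefore consists of the sections with
  -- non-invertible germ. Since `c` is the kernel of evaluation, `a` then has value 0 at `x`.
  have ha : c.1 a 0 := ((AffineOpens.eq_point_iff U _ _ hU).1 hy a).2 h
  rw [(congι_eq_gamma_iff U hU c).1 hc] at ha
  refine hs ((stalkHom_germ U hU a).trans (Eq.trans ha (map_zero _)))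

/-! ### The residue pointed group κ(γ(x)) and its embedding into κ(x)^•. -/

variable (x) in
/-- The morphism `κ(γ(x)) → κ(x)^•` induced by the factorization of `p_R` through `γ`. -/
def gammaMap : X.GammaResidue R x →*₀ (X.realization R).residueField x where
  toFun q := Con.liftOn q (stalkHom x) fun s t h => by
    rw [stalkCon_gamma] at h
    exact h
  map_zero' := map_zero (stalkHom x)
  map_one' := map_one (stalkHom x)
  map_mul' q r := by
    induction q, r using Con.induction_on₂ with
    | H s t => exact map_mul (stalkHom x) s t

theorem gammaMap_mk (s : X.Stalk (basePoint x)) :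
    gammaMap x (X.congResidueMk _ s) = stalkHom x s := rfl

theorem congResidueMk_surjective (z : X.CongSpace) : Function.Surjective (X.congResidueMk z) :=
  Quotient.mk''_surjective

-- The definition of `gammaMap` needs only that `stalkCon` is contained in the congruence kernel of
-- `stalkHom x`; injectivity is the reverse inclusion in `stalkCon_gamma`.
variable (x) in
theorem gammaMap_injective : Function.Injective (gammaMap x) := by
  intro q r h
  obtain ⟨s, rfl⟩ := congResidueMk_surjective _ q
  obtain ⟨t, rfl⟩ := congResidueMk_surjective _ r
  refine conMk_eq.2 ?_
  rw [stalkCon_gamma]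
  exact h

-- Zero is not a unit because its image in the field κ(x) is zero. A nonzero class has nonzero value
-- by injectivity, so any germ representing it is already invertible in the stalk.
variable (x) in
theorem isPointedGroup_gammaResidue : IsPointedGroup (X.GammaResidue R x) := by
  intro q
  refine ⟨?_, fun h => ?_⟩
  · rintro hq rfl
    have h := hq.map (gammaMap x)
    rw [map_zero] at h
    exact not_isUnit_zero h
  · obtain ⟨s, rfl⟩ := congResidueMk_surjective _ q
    refine (isUnit_of_stalkHom_ne_zero (x := x) fun hs => h ?_).map _
    refine gammaMap_injective x ?_
    rw [gammaMap_mk, hs, map_zero]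

end MonoidScheme
end F1

end

theorem mainTheorem6 (X : F1.MonoidScheme.{u}) (R : Type u) [CommRing R] (x : X.realization R) :
    F1.IsPointedGroup (X.GammaResidue R x) ∧
    ∃ g : X.GammaResidue R x →*₀ (X.realization R).residueField x,
      Function.Injective g ∧
      (∀ (U : X.Affines) (hx : x ∈ X.realizationOpen R U),
        g.comp (X.toGammaResidue R U x hx) = X.toResidueField R U x hx) ∧
      (∀ g' : X.GammaResidue R x →*₀ (X.realization R).residueField x,
        (∀ (U : X.Affines) (hx : x ∈ X.realizationOpen R U),
          g'.comp (X.toGammaResidue R U x hx) = X.toResidueField R U x hx) → g' = g) := by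
  have hg : ∀ (U : X.Affines) (hx : x ∈ X.realizationOpen R U),
      (F1.MonoidScheme.gammaMap x).comp (X.toGammaResidue R U x hx) =
        X.toResidueField R U x hx := fun U hx =>
    MonoidWithZeroHom.ext fun a =>
      F1.MonoidScheme.stalkHom_germ U (X.congProj_gamma_mem R hx) a
  refine ⟨F1.MonoidScheme.isPointedGroup_gammaResidue x, F1.MonoidScheme.gammaMap x,
    F1.MonoidScheme.gammaMap_injective x, hg, fun g' hg' => MonoidWithZeroHom.ext fun q => ?_⟩
  -- For uniqueness, each element of κ(γ(x)) is the class of the germ of a section over some affine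
  -- open, where the compatibility condition prescribes the value.
  obtain ⟨s, rfl⟩ := F1.MonoidScheme.congResidueMk_surjective _ q
  obtain ⟨U, hU, a, rfl⟩ := F1.MonoidScheme.exists_affine_germ s
  have hx := F1.MonoidScheme.mem_realizationOpen_of_basePoint_mem hU
  exact DFunLike.congr_fun ((hg' U hx).trans (hg U hx).symm) a
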